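/- Setup. Define the crank of a partition as its largest part if it has no ones, and otherwise as the number of parts larger than the number of ones, minus the number of ones (the empty partition has crank $0$). Let $M(m,n)$ be the number of partitions of $n$ with crank $m$, except that for $n=1$ one uses the standard convention $M(0,1)=-1$, $M(1,1)=M(-1,1)=1$ and $M(m,1)=0$ otherwise. Put $M(r,t,n)=\sum_{m\equiv r \,(\mathrm{mod}\, t)}M(m,n)$. For a prime $p>3$ let $\zeta_p=e^{2\pi i/p}$ and $s_p=\frac{p^2-1}{24}$, and for $0\le m\le p-1$, $1\le \ell\le p-1$ and $z$ in the upper half-plane, with $q=e^{2\pi i z}$ and $q^{m/p}=e^{2\pi i m z/p}$, define $$\mathcal K^{(C)}_{p,m}(\zeta_p^{\ell},z)=q^{m/p}\prod_{n=1}^{\infty}(1-q^{pn})\sum_{n=\lceil (s_p-m)/p\rceil}^{\infty}\Bigl(\sum_{k=0}^{p-1}M(k,p,pn+m-s_p)\,\zeta_p^{k\ell}\Bigr)q^n .$$ For a function $F$ on the upper half-plane and $A=\begin{pmatrix}\alpha&\beta\\ \gamma&\delta\end{pmatrix}\in \mathrm{SL}_2(\mathbb Z)$, let $(F|[A]_1)(z)=(\gamma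 z+\delta)^{-1}F\bigl(\frac{\alpha z+\beta}{\gamma z+\delta}\bigr)$. Theorem 3.1. Let $p>3$ be prime and let $A=\begin{pmatrix} a&k\\ p&d\end{pmatrix}\in\Gamma_0(p)$ with $1\le a,d\le p-1$. Then the series over $n$ defining $\mathcal K^{(C)}_{p,m}(\zeta_p^{\ell},z)$ converges absolutely for all $0\le m\le p-1$, $1\le\ell\le p-1$ and $z$ in the upper half-plane, and for every $0\le m\le p-1$, $$\mathcal K^{(C)}_{p,m}(\zeta_p,z)\,\big|\,[A]_1=\frac{\sin(\pi/p)}{\sin(d\pi/p)}\,(-1)^{d+1}\,\zeta_p^{mak}\,\mathcal K^{(C)}_{p,ma^2}(\zeta_p^{d},z),$$ where the index $ma^2$ is replaced by its least nonnegative residue modulo $p$. Moreover, $m\mapsto ma^2 \bmod p$ is a permutation of $\{0,1,\dots,p-1\}$, and $\bigl(\frac{ma^2}{p}\bigr)=\bigl(\frac{m}{p}\bigr)$ (Legendre symbol) for all $0\le m\le p-1$. -/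

import Mathlib

open scoped UpperHalfPlane MatrixGroups ModularForm

noncomputable section

namespace CrankDissection

/-- The Andrews-Garvan crank of a partition: the largest part if there are no ones, and otherwise
(number of parts larger than the number of ones) minus (number of ones).
The empty partition gets crank `0`. -/
def crank {n : ℕ} (π : n.Partition) : ℤ :=
  if π.parts.count 1 = 0 then (π.parts.sup : ℤ)
  else (π.parts.countP (fun i => π.parts.count 1 < i) : ℤ) - (π.parts.count 1 : ℤ)

/-- `crankCount r t n` is `M(r,t,n)`: the number of partitions of `n` with crank congruent to `r`
modulo `t`.  For `n = 1` the usual convention `M(0,1) = -1`, `M(1,1) = M(-1,1) = 1` and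
`M(m,1) = 0` for other `m` is in force (it makes the product
`(q;q)_∞ / ((zq;q)_∞ (q/z;q)_∞)` the generating function of the crank), and `M(r,t,1)` is the sum
of `M(m,1)` over `m ≡ r` modulo `t`. -/
def crankCount (r t n : ℕ) : ℤ :=
  if n = 1 then
    ∑ m ∈ ({-1, 0, 1} : Finset ℤ).filter (fun m => m ≡ (r : ℤ) [ZMOD (t : ℤ)]),
      if m = 0 then -1 else 1
  else
    ((Finset.univ.filter
      (fun π : n.Partition => crank π ≡ (r : ℤ) [ZMOD (t : ℤ)])).card : ℤ)

/-- `ζ_p = exp(2πi/p)`. -/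
def zeta (p : ℕ) : ℂ := Complex.exp (2 * (Real.pi : ℂ) * Complex.I / (p : ℂ))

/-- `q = exp(2πiz)`. -/
def nome (z : ℍ) : ℂ := Complex.exp (2 * (Real.pi : ℂ) * Complex.I * (z : ℂ))

/-- `s_p = (p² - 1)/24`, an integer when `p > 3` is prime. -/
def shift (p : ℕ) : ℕ := (p ^ 2 - 1) / 24

/-- The `n`-th term `(∑_{k=0}^{p-1} M(k,p,pn+m-s_p) ω^k) q^n` of the dissection series, present
when `pn + m - s_p ≥ 0`, that is when `n ≥ ⌈(s_p - m)/p⌉`.  For `0 ≤ m ≤ p - 1` this bound is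
`≥ 0`, so that natural numbers `n` suffice. -/
def seriesTerm (p m : ℕ) (ω : ℂ) (z : ℍ) (n : ℕ) : ℂ :=
  if shift p ≤ p * n + m then
    (∑ k ∈ Finset.range p, (crankCount k p (p * n + m - shift p) : ℂ) * ω ^ k) * nome z ^ n
  else 0

/-- The element
`K_{p,m}(ω, z) = q^{m/p} ∏_{n ≥ 1} (1 - q^{pn}) ∑_n (∑_{k=0}^{p-1} M(k,p,pn+m-s_p) ω^k) q^n`
of the crank dissection, where `q^{m/p} = exp(2πimz/p)`. -/
def K (p m : ℕ) (ω : ℂ) (z : ℍ) : ℂ :=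
  Complex.exp (2 * (Real.pi : ℂ) * Complex.I * (m : ℂ) * (z : ℂ) / (p : ℂ)) *
    (∏' n : ℕ, (1 - nome z ^ (p * (n + 1)))) *
    ∑' n : ℕ, seriesTerm p m ω z n

end CrankDissection

end

namespace CrankDissection

open Filter Topology

/-! Put `x = e(z/p)`. Sorting exponents by residue modulo `p` shows that the functions `K p m ω z`,
`m < p`, are exactly the pieces of `x ^ s_p * (x^(p²); x^(p²))_∞` times the crank generating
function at `(ω, x)`. By the Andrews-Garvan product (`tsum_crankCoeff`), for `ω = ζ_p ^ l` their sum
is `2i sin(πl/p) * etaQuot / thetaQuot` at `τ = z/p`, where `etaQuot` is `η(p²τ)/η(τ)` and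
`thetaQuot` is a theta function at `l/p` divided by `η³` (`sum_K_eq_thetaQuot`).

Both factors transform simply. The Klein form built from `thetaQuot` has weight `-1`, and `SL(2, ℤ)`
acts on its characteristic `(r, s)` linearly (`klein_slash`); this rests on the Jacobi triple
product and the inversion formula of `jacobiTheta₂`. The eta quotient is handled without the eta
multiplier system: it is a constant times a product of values of `thetaQuot` at `l/p` and a power of
the discriminant, in which weights, signs and roots of unity all cancel (`etaQuot_smul`).

To recover the individual `m`, note that `z ↦ z + t` multiplies `K p m` by `ζ_p ^ (m t)` (`K_vadd`).
For each `j` and a suitable `t`, the point `(A z + t)/p` is the image of `(z + j)/p` under an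
integral matrix with lower row `(p², d - p j)`, so the summed series at `A z + t` is a multiple of
the one at `z + j` (`sum_K_smul`). Fourier inversion over `j` modulo `p` then isolates `m` on one
side and `m a²` on the other (`K_slash`). -/

/-! ### Sums over multisets as Euler products -/

/-- Induction on the bound: splitting off the copies of `N` from a multiset multiplies the previous
sum by the geometric series in `g N`. -/
lemma hasSum_multiset_lt {g : ℕ → ℂ} (hg : ∀ i, ‖g i‖ < 1) (N : ℕ) :
    HasSum (fun s : Multiset ℕ => if ∀ i ∈ s, i < N then (s.map g).prod else 0)
      (∏ i ∈ Finset.range N, (1 - g i)⁻¹) := by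
  induction N with
  | zero =>
    have h : (fun s : Multiset ℕ => if ∀ i ∈ s, i < 0 then (s.map g).prod else 0) =
        fun s => if s = 0 then 1 else 0 := by
      funext s
      by_cases hs : s = 0
      · simp [hs]
      · obtain ⟨x, hx⟩ := Multiset.exists_mem_of_ne_zero hs
        rw [if_neg hs, if_neg]
        intro h
        exact absurd (h x hx) (Nat.not_lt_zero x)
    rw [h]
    simpa using hasSum_ite_eq (0 : Multiset ℕ) (1 : ℂ)
  | succ N ih =>
    have hgeo := hasSum_geometric_of_norm_lt_one (hg N)
    have hsm := summable_mul_of_summable_norm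
      (f := fun s : Multiset ℕ => if ∀ i ∈ s, i < N then (s.map g).prod else 0)
      (g := fun c : ℕ => g N ^ c) ih.summable.norm hgeo.summable.norm
    have hprod := ih.mul hgeo hsm
    let ψ : Multiset ℕ → Multiset ℕ × ℕ := fun s => (s.filter (· ≠ N), s.count N)
    have key : ∀ s : Multiset ℕ, s.filter (· ≠ N) + Multiset.replicate (s.count N) N = s := by
      intro s
      rw [← Multiset.filter_eq' s N, add_comm]
      exact Multiset.filter_add_not (· = N) s
    have hψ : Function.Injective ψ := by
      intro s t hst
      rw [← key s, ← key t]
      simp only [ψ, Prod.mk.injEq] at hst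
      rw [hst.1, hst.2]
    rw [Finset.prod_range_succ]
    rw [← hψ.hasSum_iff] at hprod
    · refine (congrArg (HasSum · _) (funext fun s => ?_)).mpr hprod
      simp only [Function.comp, ψ]
      have hiff : (∀ i ∈ s, i < N + 1) ↔ ∀ i ∈ s.filter (· ≠ N), i < N := by
        simp only [Multiset.mem_filter]
        constructor
        · rintro h i ⟨hi, hne⟩
          have := h i hi
          omega
        · intro h i hi
          by_cases hiN : i = N
          · omega
          · have := h i ⟨hi, hiN⟩
            omega
      simp only [← hiff, ite_mul, zero_mul]
      congr 1
      conv_lhs => rw [← key s]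
      simp
    -- `ψ` misses only pairs whose first entry contains `N`; the summand vanishes there, so the
    -- reindexing loses nothing.
    · rintro ⟨s, c⟩ hx
      rw [if_neg, zero_mul]
      intro hlt
      apply hx
      have hN : N ∉ s := fun h => lt_irrefl _ (hlt N h)
      refine ⟨s + Multiset.replicate c N, ?_⟩
      simp only [ψ, Prod.mk.injEq, Multiset.filter_add, Multiset.count_add,
        Multiset.count_eq_zero_of_notMem hN, Multiset.count_replicate_self, zero_add, and_true]
      rw [Multiset.filter_eq_self.2 (fun a ha => by rintro rfl; exact hN ha),
        Multiset.filter_eq_nil.2 (fun a ha => by simp [Multiset.eq_of_mem_replicate ha])]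
      simp

lemma multipliable_inv_one_sub {g : ℕ → ℂ} (hg : ∀ i, ‖g i‖ < 1) (hs : Summable (fun i => ‖g i‖)) :
    Multipliable (fun i => (1 - g i)⁻¹) ∧ ∏' i, (1 - g i)⁻¹ = (∏' i, (1 - g i))⁻¹ := by
  have hm : Multipliable (fun i => 1 - g i) := by
    simpa [sub_eq_add_neg] using multipliable_one_add_of_summable (f := fun i => -g i) (by simpa)
  have hne : ∏' i, (1 - g i) ≠ 0 := by
    have := tprod_one_add_ne_zero_of_summable (f := fun i => -g i)
      (fun i h => by
        have h1 : g i = 1 := by linear_combination -h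
        have := hg i
        simp [h1] at this) (by simpa)
    simpa [sub_eq_add_neg] using this
  have h := hm.hasProd.inv₀ hne
  exact ⟨h.multipliable, h.tprod_eq⟩

/-- Every finite family of multisets is bounded by some `N`, so its sum of norms is at most a
partial product formed with `‖g i‖`; these partial products converge, hence are bounded. -/
lemma summable_multiset_prod {g : ℕ → ℂ} (hg : ∀ i, ‖g i‖ < 1) (hs : Summable (fun i => ‖g i‖)) :
    Summable (fun s : Multiset ℕ => (s.map g).prod) := by
  set G : ℕ → ℂ := fun i => (‖g i‖ : ℂ) with hG
  have hGn : ∀ i, ‖G i‖ = ‖g i‖ := fun i => by simp [hG]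
  have hGlt : ∀ i, ‖G i‖ < 1 := fun i => by rw [hGn]; exact hg i
  have hm := (multipliable_inv_one_sub hGlt (by simpa only [hGn] using hs)).1
  have hb : BddAbove (Set.range fun N => ‖∏ i ∈ Finset.range N, (1 - G i)⁻¹‖) :=
    (hm.hasProd.tendsto_prod_nat.norm).bddAbove_range
  obtain ⟨B, hB⟩ := hb
  refine Summable.of_norm (summable_of_sum_le (c := B) (fun s => norm_nonneg _) fun T => ?_)
  have hnorm : ∀ s : Multiset ℕ, (‖(s.map g).prod‖ : ℂ) = (s.map G).prod := by
    intro s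
    induction s using Multiset.induction with
    | empty => simp
    | cons a s ih => simp [ih, hG]
  obtain ⟨N, hN⟩ : ∃ N, ∀ s ∈ T, ∀ i ∈ s, i < N := by
    refine ⟨T.sup (fun s => s.sup) + 1, fun s hs i hi => Nat.lt_succ_of_le ?_⟩
    exact (Multiset.le_sup hi).trans (Finset.le_sup (f := fun s : Multiset ℕ => s.sup) hs)
  have hsum := hasSum_multiset_lt hGlt N
  have hsumR : HasSum (fun s : Multiset ℕ => if ∀ i ∈ s, i < N then ‖(s.map g).prod‖ else 0)
      ((∏ i ∈ Finset.range N, (1 - G i)⁻¹).re) := by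
    convert Complex.hasSum_re hsum using 2 with s
    rw [← hnorm]
    split_ifs <;> simp
  calc ∑ s ∈ T, ‖(s.map g).prod‖
      = ∑ s ∈ T, (if ∀ i ∈ s, i < N then ‖(s.map g).prod‖ else 0) :=
        Finset.sum_congr rfl fun s hs => by rw [if_pos (hN s hs)]
    _ ≤ (∏ i ∈ Finset.range N, (1 - G i)⁻¹).re :=
        sum_le_hasSum T (fun s _ => by split_ifs <;> positivity) hsumR
    _ ≤ _ := Complex.re_le_norm _
    _ ≤ B := hB ⟨N, rfl⟩

lemma tendsto_tsum_multiset_lt {f : Multiset ℕ → ℂ} (hf : Summable f) :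
    Tendsto (fun N : ℕ => ∑' s : Multiset ℕ, if ∀ i ∈ s, i < N then f s else 0) atTop
      (𝓝 (∑' s, f s)) := by
  refine tendsto_tsum_of_dominated_convergence hf.norm (fun s => ?_) (Eventually.of_forall fun N s => ?_)
  · refine tendsto_const_nhds.congr' ?_
    filter_upwards [eventually_ge_atTop (s.sup + 1)] with N hN
    rw [if_pos]
    intro i hi
    have := Multiset.le_sup hi
    omega
  · split_ifs <;> simp

lemma tsum_multiset_prod {g : ℕ → ℂ} (hg : ∀ i, ‖g i‖ < 1) (hs : Summable (fun i => ‖g i‖)) :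
    ∑' s : Multiset ℕ, (s.map g).prod = (∏' i, (1 - g i))⁻¹ := by
  have h1 := tendsto_tsum_multiset_lt (summable_multiset_prod hg hs)
  obtain ⟨hm, he⟩ := multipliable_inv_one_sub hg hs
  rw [← he]
  refine tendsto_nhds_unique h1 (hm.hasProd.tendsto_prod_nat.congr fun N => ?_)
  exact ((hasSum_multiset_lt hg N).tsum_eq).symm

/-! ### q-Pochhammer symbols and the q-binomial theorem -/

/-- The `q`-Pochhammer symbol `(a;q)_n`. -/
noncomputable def qPoch (a q : ℂ) (n : ℕ) : ℂ := ∏ i ∈ Finset.range n, (1 - a * q ^ i)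

/-- The infinite `q`-Pochhammer symbol `(a;q)_∞`. -/
noncomputable def qPochInf (a q : ℂ) : ℂ := ∏' i : ℕ, (1 - a * q ^ i)

lemma summable_norm_mul_pow (a : ℂ) {q : ℂ} (hq : ‖q‖ < 1) : Summable (fun i : ℕ => ‖a * q ^ i‖) := by
  simpa [norm_mul, norm_pow] using (summable_geometric_of_lt_one (norm_nonneg q) hq).mul_left ‖a‖

lemma multipliable_one_sub {f : ℕ → ℂ} (hf : Summable (fun i => ‖f i‖)) :
    Multipliable (fun i => 1 - f i) := by
  simpa [sub_eq_add_neg] using multipliable_one_add_of_summable (f := fun i => -f i) (by simpa)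

lemma tprod_one_sub_ne_zero {f : ℕ → ℂ} (hf : Summable (fun i => ‖f i‖)) (h : ∀ i, f i ≠ 1) :
    ∏' i, (1 - f i) ≠ 0 := by
  have := tprod_one_add_ne_zero_of_summable (f := fun i => -f i)
      (fun i hi => h i (by linear_combination -hi)) (by simpa)
  simpa [sub_eq_add_neg] using this

lemma qPochInf_eq_qPoch_mul (a : ℂ) {q : ℂ} (hq : ‖q‖ < 1) (n : ℕ) :
    qPochInf a q = qPoch a q n * qPochInf (a * q ^ n) q := by
  have h := (multipliable_one_sub (summable_norm_mul_pow a hq))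
  have h' := (multipliable_one_sub (summable_norm_mul_pow (a * q ^ n) hq))
  rw [qPochInf, qPoch, qPochInf]
  rw [← Multipliable.prod_mul_tprod_nat_mul' (k := n) (f := fun i => 1 - a * q ^ i)]
  · congr 1
    exact tprod_congr fun i => by ring
  · refine h'.congr fun i => by ring

lemma qPochInf_eq_mul (a : ℂ) {q : ℂ} (hq : ‖q‖ < 1) :
    qPochInf a q = (1 - a) * qPochInf (a * q) q := by
  simpa [qPoch] using qPochInf_eq_qPoch_mul a hq 1

lemma tendsto_qPoch (a : ℂ) {q : ℂ} (hq : ‖q‖ < 1) :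
    Tendsto (qPoch a q) atTop (𝓝 (qPochInf a q)) :=
  (multipliable_one_sub (summable_norm_mul_pow a hq)).hasProd.tendsto_prod_nat

lemma mul_pow_ne_one {a q : ℂ} (ha : ‖a‖ < 1) (hq : ‖q‖ < 1) (i : ℕ) : a * q ^ i ≠ 1 := by
  intro h
  have h1 : ‖a * q ^ i‖ < 1 := by
    rw [norm_mul, norm_pow]
    calc ‖a‖ * ‖q‖ ^ i ≤ ‖a‖ * 1 := by gcongr; exact pow_le_one₀ (norm_nonneg _) hq.le
      _ < 1 := by simpa
  simp [h] at h1

lemma qPochInf_ne_zero {a q : ℂ} (ha : ‖a‖ < 1) (hq : ‖q‖ < 1) : qPochInf a q ≠ 0 :=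
  tprod_one_sub_ne_zero (summable_norm_mul_pow a hq) (mul_pow_ne_one ha hq)

lemma qPoch_ne_zero {a q : ℂ} (ha : ‖a‖ < 1) (hq : ‖q‖ < 1) (n : ℕ) : qPoch a q n ≠ 0 :=
  Finset.prod_ne_zero_iff.2 fun i _ => sub_ne_zero.2 (mul_pow_ne_one ha hq i).symm

lemma qPoch_succ (a q : ℂ) (n : ℕ) : qPoch a q (n + 1) = qPoch a q n * (1 - a * q ^ n) :=
  Finset.prod_range_succ _ _

lemma exists_norm_qPoch_div_le (a : ℂ) {q : ℂ} (hq : ‖q‖ < 1) :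
    ∃ C : ℝ, ∀ n, ‖qPoch a q n / qPoch q q n‖ ≤ C := by
  have h := ((tendsto_qPoch a hq).div (tendsto_qPoch q hq) (qPochInf_ne_zero hq hq)).norm
  obtain ⟨C, hC⟩ := h.bddAbove_range
  exact ⟨C, fun n => hC ⟨n, rfl⟩⟩

lemma summable_qBinomial (a : ℂ) {q t : ℂ} (hq : ‖q‖ < 1) (ht : ‖t‖ < 1) :
    Summable (fun n => ‖qPoch a q n / qPoch q q n * t ^ n‖) := by
  obtain ⟨C, hC⟩ := exists_norm_qPoch_div_le a hq
  refine Summable.of_nonneg_of_le (fun _ => norm_nonneg _) (fun n => ?_)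
    ((summable_geometric_of_lt_one (norm_nonneg t) ht).mul_left C)
  rw [norm_mul, norm_pow]
  gcongr
  exact hC n

/-- This is the coefficient recurrence `(1 - q^(n+1)) c_(n+1) = (1 - a q^n) c_n`, summed against
`t^(n+1)`. -/
lemma qBinomial_functional (a : ℂ) {q t : ℂ} (hq : ‖q‖ < 1) (ht : ‖t‖ < 1) :
    (1 - t) * ∑' n, qPoch a q n / qPoch q q n * t ^ n =
      (1 - a * t) * ∑' n, qPoch a q n / qPoch q q n * (t * q) ^ n := by
  have htq : ‖t * q‖ < 1 := by
    rw [norm_mul]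
    exact mul_lt_one_of_nonneg_of_lt_one_left (norm_nonneg _) ht hq.le
  have h1 := (summable_qBinomial a hq ht).of_norm
  have h2 := (summable_qBinomial a hq htq).of_norm
  set c := fun n => qPoch a q n / qPoch q q n with hc
  have hrec : ∀ n, (1 - q ^ (n + 1)) * c (n + 1) = (1 - a * q ^ n) * c n := by
    intro n
    have hn := qPoch_ne_zero hq hq n
    have hn1 := qPoch_ne_zero hq hq (n + 1)
    have e1 := qPoch_succ a q n
    have e2 := qPoch_succ q q n
    have e3 : (1 - q * q ^ n) ≠ 0 := fun h => hn1 (by rw [e2, h, mul_zero])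
    simp only [hc]
    rw [e1, e2, pow_succ']
    generalize q * q ^ n = x at e3
    field_simp
  have h3 : ∑' n, c n * t ^ n - ∑' n, c n * (t * q) ^ n =
      ∑' n, (c n * t ^ (n + 1) - a * (c n * (t * q) ^ n * t)) := by
    rw [← h1.tsum_sub h2, (h1.sub h2).tsum_eq_zero_add]
    simp only [pow_zero, mul_one, sub_self, zero_add]
    refine tsum_congr fun n => ?_
    rw [mul_pow t q, mul_pow t q]
    linear_combination t ^ (n + 1) * hrec n
  have h4 : ∑' n, (c n * t ^ (n + 1) - a * (c n * (t * q) ^ n * t)) =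
      (∑' n, c n * t ^ n) * t - a * ((∑' n, c n * (t * q) ^ n) * t) := by
    rw [← tsum_mul_right, ← tsum_mul_right, ← tsum_mul_left,
      ← (h1.mul_right t).tsum_sub ((h2.mul_right t).mul_left a)]
    exact tsum_congr fun n => by ring
  rw [h4] at h3
  linear_combination h3

/-- The `q`-binomial theorem. -/
theorem qBinomial (a : ℂ) {q t : ℂ} (hq : ‖q‖ < 1) (ht : ‖t‖ < 1) :
    ∑' n, qPoch a q n / qPoch q q n * t ^ n = qPochInf (a * t) q / qPochInf t q := by
  have htq : ∀ N : ℕ, ‖t * q ^ N‖ ≤ ‖t‖ := fun N => by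
    rw [norm_mul, norm_pow]
    exact mul_le_of_le_one_right (norm_nonneg _) (pow_le_one₀ (norm_nonneg _) hq.le)
  set F : ℂ → ℂ := fun t => ∑' n, qPoch a q n / qPoch q q n * t ^ n with hF
  -- Iterating the functional equation pushes the argument to `t * q ^ N`, which tends to `0`, where
  -- only the constant term `1` survives.
  have hiter : ∀ N, F t * qPoch t q N = qPoch (a * t) q N * F (t * q ^ N) := by
    intro N
    induction N with
    | zero => simp [qPoch]
    | succ N ih =>
      have := qBinomial_functional a hq ((htq N).trans_lt ht)
      rw [qPoch_succ, qPoch_succ, pow_succ, ← mul_assoc t]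
      simp only [hF] at ih ⊢
      linear_combination (1 - t * q ^ N) * ih + qPoch (a * t) q N * this
  have hlim : Tendsto (fun N => F (t * q ^ N)) atTop (𝓝 (∑' n : ℕ, if n = 0 then (1 : ℂ) else 0)) := by
    refine tendsto_tsum_of_dominated_convergence (summable_qBinomial a hq ht) (fun n => ?_)
      (Eventually.of_forall fun N n => ?_)
    · rcases Nat.eq_zero_or_pos n with rfl | hn
      · simp [qPoch]
      · rw [if_neg hn.ne']
        have h0 : Tendsto (fun N => qPoch a q n / qPoch q q n * (t * q ^ N) ^ n) atTop
            (𝓝 (qPoch a q n / qPoch q q n * (t * 0) ^ n)) :=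
          (((tendsto_pow_atTop_nhds_zero_of_norm_lt_one hq).const_mul t).pow n).const_mul _
        simpa [hn.ne'] using h0
    · rw [norm_mul, norm_mul, norm_pow, norm_pow]
      gcongr
      exact htq N
  rw [tsum_ite_eq] at hlim
  have h1 := (tendsto_qPoch t hq).const_mul (F t)
  have h2 := ((tendsto_qPoch (a * t) hq).mul hlim)
  have h3 := tendsto_nhds_unique (h1.congr hiter) h2
  rw [eq_div_iff (qPochInf_ne_zero ht hq)]
  simpa using h3

lemma qPoch_zero_left (q : ℂ) (n : ℕ) : qPoch 0 q n = 1 := by simp [qPoch]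

lemma qPochInf_zero_left (q : ℂ) : qPochInf 0 q = 1 := by simp [qPochInf]

lemma qPoch_succ_left (a q : ℂ) (n : ℕ) : qPoch a q (n + 1) = (1 - a) * qPoch (a * q) q n := by
  rw [qPoch, Finset.prod_range_succ', qPoch, mul_comm]
  congr 1
  · simp
  · exact Finset.prod_congr rfl fun i _ => by ring

/-! ### The generating function of the crank -/

/-- The crank of the partition with `j` ones and the further parts `i + 2`, for `i ∈ s`. -/
def multisetCrank (j : ℕ) (s : Multiset ℕ) : ℤ :=
  if j = 0 then (((s.map (· + 2)).sup : ℕ) : ℤ) else ((s.countP (j < · + 2) : ℕ) : ℤ) - j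

/-- Once the number of ones is fixed, the crank is additive over the other parts: a part weighs `ω`
if it exceeds that number and `1` otherwise. The sum is therefore an Euler product, written here as
a term of the q-binomial series with `a = ω q` and `t = q / ω`. -/
lemma tsum_multisetCrank_succ {ω q : ℂ} (hω : ‖ω‖ = 1) (hq : ‖q‖ < 1) (k : ℕ) :
    ∑' s : Multiset ℕ, ω ^ multisetCrank (k + 1) s * (q ^ (k + 1) * (s.map (fun i => q ^ (i + 2))).prod) =
      (1 - q) / qPochInf (ω * q) q *
        (qPoch (ω * q) q (k + 1) / qPoch q q (k + 1) * (q / ω) ^ (k + 1)) := by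
  have hω0 : ω ≠ 0 := by rintro rfl; simp at hω
  set g : ℕ → ℂ := fun i => (if k + 1 < i + 2 then ω else 1) * q ^ (i + 2) with hgdef
  have hgn : ∀ i, ‖g i‖ = ‖q‖ ^ (i + 2) := by
    intro i
    simp only [hgdef]
    split_ifs <;> simp [hω]
  have hg1 : ∀ i, ‖g i‖ < 1 := fun i => by
    rw [hgn]; exact pow_lt_one₀ (norm_nonneg _) hq (by omega)
  have hgs : Summable fun i => ‖g i‖ := by
    simp only [hgn]
    exact (summable_nat_add_iff 2).2 (summable_geometric_of_lt_one (norm_nonneg q) hq)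
  have hterm : ∀ s : Multiset ℕ,
      ω ^ multisetCrank (k + 1) s * (q ^ (k + 1) * (s.map (fun i => q ^ (i + 2))).prod) =
        (q / ω) ^ (k + 1) * (s.map g).prod := by
    intro s
    have h1 : (s.map g).prod = ω ^ (s.countP (k + 1 < · + 2)) * (s.map (fun i => q ^ (i + 2))).prod := by
      induction s using Multiset.induction with
      | empty => simp
      | cons a s ih =>
        rw [Multiset.map_cons, Multiset.prod_cons, ih, Multiset.countP_cons, Multiset.map_cons,
          Multiset.prod_cons]
        simp only [hgdef]
        split_ifs <;> ring
    rw [h1, multisetCrank, if_neg (Nat.succ_ne_zero k), zpow_sub₀ hω0, zpow_natCast, zpow_natCast,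
      div_pow]
    field_simp
  simp only [hterm]
  rw [tsum_mul_left, tsum_multiset_prod hg1 hgs]
  have hprod : ∏' i, (1 - g i) = qPoch (q * q) q k * qPochInf (ω * q * q ^ (k + 1)) q := by
    have h' := multipliable_one_sub (summable_norm_mul_pow (ω * q * q ^ (k + 1)) hq)
    have e : ∀ i, 1 - g (i + k) = 1 - ω * q * q ^ (k + 1) * q ^ i := by
      intro i
      simp only [hgdef]
      rw [if_pos (by omega)]
      ring
    rw [← Multipliable.prod_mul_tprod_nat_mul' (k := k) (f := fun i => 1 - g i)]
    · congr 1
      · refine Finset.prod_congr rfl fun i hi => ?_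
        have := Finset.mem_range.1 hi
        simp only [hgdef]
        rw [if_neg (by omega)]
        ring
      · exact tprod_congr e
    · exact h'.congr fun i => (e i).symm
  have hωq : ‖ω * q‖ < 1 := by rwa [norm_mul, hω, one_mul]
  have hX := qPochInf_ne_zero hωq hq
  have hX2 := qPochInf_eq_qPoch_mul (ω * q) hq (k + 1)
  have hQ := qPoch_ne_zero hq hq (k + 1)
  rw [hprod]
  rw [hX2] at hX ⊢
  have hXa := left_ne_zero_of_mul hX
  have hXb := right_ne_zero_of_mul hX
  rw [qPoch_succ_left q q k] at hQ ⊢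
  have hQa := left_ne_zero_of_mul hQ
  have hQb := right_ne_zero_of_mul hQ
  generalize qPoch (ω * q) q (k + 1) = a₁ at *
  generalize qPochInf (ω * q * q ^ (k + 1)) q = a₂ at *
  generalize qPoch (q * q) q k = a₃ at *
  field_simp

lemma summable_multiset_pow {q : ℂ} (hq : ‖q‖ < 1) :
    Summable fun s : Multiset ℕ => (s.map (fun i => q ^ (i + 2))).prod := by
  refine summable_multiset_prod (fun i => ?_) ?_
  · rw [norm_pow]; exact pow_lt_one₀ (norm_nonneg _) hq (by omega)
  · simp only [norm_pow]
    exact (summable_nat_add_iff 2).2 (summable_geometric_of_lt_one (norm_nonneg q) hq)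

/-- Without ones the crank is the largest part. Multisets with maximum exactly `N` carry the
constant weight `ω ^ (N + 2)`, and are counted by the difference of two consecutive reciprocal
Pochhammer symbols. -/
lemma hasSum_multisetCrank_zero_lt {ω q : ℂ} (hq : ‖q‖ < 1) (N : ℕ) :
    HasSum (fun s : Multiset ℕ => if ∀ i ∈ s, i < N then
        ω ^ multisetCrank 0 s * (s.map (fun i => q ^ (i + 2))).prod else 0)
      (1 + ∑ i ∈ Finset.range N, (ω * q) ^ (i + 2) / qPoch (q * q) q (i + 1)) := by
  have hq' : ∀ i, ‖q ^ (i + 2)‖ < 1 := fun i => by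
    rw [norm_pow]; exact pow_lt_one₀ (norm_nonneg _) hq (by omega)
  have hqq : ‖q * q‖ < 1 := by simpa [pow_two] using hq' 0
  have hb : ∀ N, HasSum (fun s : Multiset ℕ => if ∀ i ∈ s, i < N then
      (s.map (fun i => q ^ (i + 2))).prod else 0) (qPoch (q * q) q N)⁻¹ := by
    intro N
    have h := hasSum_multiset_lt hq' N
    rwa [Finset.prod_inv_distrib, show ∏ i ∈ Finset.range N, (1 - q ^ (i + 2)) = qPoch (q * q) q N
      from Finset.prod_congr rfl fun i _ => by ring] at h
  induction N with
  | zero =>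
    have h : (fun s : Multiset ℕ => if ∀ i ∈ s, i < 0 then
        ω ^ multisetCrank 0 s * (s.map (fun i => q ^ (i + 2))).prod else 0) =
        fun s => if ∀ i ∈ s, i < 0 then (s.map (fun i => q ^ (i + 2))).prod else 0 := by
      funext s
      by_cases hs : s = 0
      · simp [hs, multisetCrank]
      · obtain ⟨x, hx⟩ := Multiset.exists_mem_of_ne_zero hs
        have hn : ¬ ∀ i ∈ s, i < 0 := fun h => absurd (h x hx) (Nat.not_lt_zero x)
        rw [if_neg hn, if_neg hn]
    rw [h]
    simpa [qPoch] using hb 0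
  | succ N ih =>
    have h := ih.add (((hb (N + 1)).sub (hb N)).mul_left (ω ^ (N + 2)))
    have hN1 := qPoch_ne_zero hqq hq (N + 1)
    have hv : 1 + ∑ i ∈ Finset.range N, (ω * q) ^ (i + 2) / qPoch (q * q) q (i + 1) +
        ω ^ (N + 2) * ((qPoch (q * q) q (N + 1))⁻¹ - (qPoch (q * q) q N)⁻¹) =
        1 + ∑ i ∈ Finset.range (N + 1), (ω * q) ^ (i + 2) / qPoch (q * q) q (i + 1) := by
      rw [Finset.sum_range_succ, ← add_assoc]
      congr 1
      rw [qPoch_succ] at hN1 ⊢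
      have ha := left_ne_zero_of_mul hN1
      have hb' := right_ne_zero_of_mul hN1
      generalize qPoch (q * q) q N = A at *
      have e : q ^ (N + 2) = q * q * q ^ N := by ring
      rw [mul_pow, e]
      generalize q * q * q ^ N = B at *
      field_simp
      ring
    rw [hv] at h
    refine (congrArg (HasSum · _) (funext fun s => ?_)).mpr h
    by_cases h1 : ∀ i ∈ s, i < N
    · have h2 : ∀ i ∈ s, i < N + 1 := fun i hi => (h1 i hi).trans (Nat.lt_succ_self N)
      simp only [if_pos h1, if_pos h2]
      ring
    · by_cases h2 : ∀ i ∈ s, i < N + 1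
      · simp only [if_neg h1, if_pos h2]
        have hsup : (s.map (· + 2)).sup = N + 2 := by
          apply le_antisymm
          · refine Multiset.sup_le.2 fun b hb => ?_
            obtain ⟨i, hi, rfl⟩ := Multiset.mem_map.1 hb
            have := h2 i hi
            omega
          · push Not at h1
            obtain ⟨i, hi, hNi⟩ := h1
            have h3 := h2 i hi
            obtain rfl : i = N := by omega
            exact Multiset.le_sup (Multiset.mem_map_of_mem (· + 2) hi)
        rw [multisetCrank, if_pos rfl, hsup, zpow_natCast]
        ring
      · simp only [if_neg h1, if_neg h2]
        ring

/-- The series over the largest part is the q-binomial series with `a = 0` minus its first two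
terms; these omitted terms produce the stray `q - ω q` of degree one. -/
lemma tsum_multisetCrank_zero {ω q : ℂ} (hω : ‖ω‖ = 1) (hq : ‖q‖ < 1) :
    ∑' s : Multiset ℕ, ω ^ multisetCrank 0 s * (s.map (fun i => q ^ (i + 2))).prod =
      (1 - q) / qPochInf (ω * q) q + q - ω * q := by
  have hωq : ‖ω * q‖ < 1 := by rwa [norm_mul, hω, one_mul]
  have hqq : ‖q * q‖ < 1 := by
    rw [norm_mul]; exact mul_lt_one_of_nonneg_of_lt_one_left (norm_nonneg _) hq hq.le
  have hq1 : 1 - q ≠ 0 := sub_ne_zero.2 (by rintro rfl; simp at hq)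
  have hs : Summable fun s : Multiset ℕ => ω ^ multisetCrank 0 s * (s.map (fun i => q ^ (i + 2))).prod := by
    refine Summable.of_norm ?_
    simpa [hω] using (summable_multiset_pow hq).norm
  have h1 := tendsto_tsum_multiset_lt hs
  have hb := qBinomial 0 hq hωq
  have hbs := (summable_qBinomial 0 hq hωq).of_norm
  simp only [qPoch_zero_left, zero_mul, qPochInf_zero_left] at hb hbs
  have hterm : ∀ i, (ω * q) ^ (i + 2) / qPoch (q * q) q (i + 1) =
      (1 - q) * (1 / qPoch q q (i + 2) * (ω * q) ^ (i + 2)) := by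
    intro i
    have := qPoch_ne_zero hqq hq (i + 1)
    rw [qPoch_succ_left q q (i + 1)]
    field_simp
  have h2 : HasSum (fun i => (ω * q) ^ (i + 2) / qPoch (q * q) q (i + 1))
      ((1 - q) * (1 / qPochInf (ω * q) q - ∑ i ∈ Finset.range 2, 1 / qPoch q q i * (ω * q) ^ i)) := by
    simp only [hterm]
    refine HasSum.mul_left _ ?_
    refine (hasSum_nat_add_iff' 2).2 ?_
    rw [← hb]
    exact hbs.hasSum
  have h3 := (h2.tendsto_sum_nat).const_add 1
  have h4 := tendsto_nhds_unique (h1.congr fun N => (hasSum_multisetCrank_zero_lt hq N).tsum_eq) h3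
  rw [h4]
  have hX := qPochInf_ne_zero hωq hq
  simp only [Finset.sum_range_succ, Finset.sum_range_zero, qPoch, Finset.prod_range_succ,
    Finset.prod_range_zero, pow_zero, mul_one, one_mul, pow_one]
  field_simp
  ring

lemma summable_multisetCrank {ω q : ℂ} (hω : ‖ω‖ = 1) (hq : ‖q‖ < 1) :
    Summable fun x : ℕ × Multiset ℕ =>
      ω ^ multisetCrank x.1 x.2 * (q ^ x.1 * (x.2.map (fun i => q ^ (i + 2))).prod) := by
  refine Summable.of_norm ?_
  have h := summable_mul_of_summable_norm (f := fun j : ℕ => q ^ j)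
    (g := fun s : Multiset ℕ => (s.map (fun i => q ^ (i + 2))).prod)
    (by simpa using summable_geometric_of_lt_one (norm_nonneg q) hq) (summable_multiset_pow hq).norm
  simpa [hω] using h.norm

/-- The generating function of the crank, before the correction in degree one. -/
theorem tsum_multisetCrank {ω q : ℂ} (hω : ‖ω‖ = 1) (hq : ‖q‖ < 1) :
    ∑' x : ℕ × Multiset ℕ,
      ω ^ multisetCrank x.1 x.2 * (q ^ x.1 * (x.2.map (fun i => q ^ (i + 2))).prod) =
      qPochInf q q / (qPochInf (ω * q) q * qPochInf (q / ω) q) + q - ω * q := by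
  have hωq : ‖ω * q‖ < 1 := by rwa [norm_mul, hω, one_mul]
  have hqω : ‖q / ω‖ < 1 := by rwa [norm_div, hω, div_one]
  have hω0 : ω ≠ 0 := by rintro rfl; simp at hω
  have hs := summable_multisetCrank hω hq
  have hb := qBinomial (ω * q) hq hqω
  have hbs := (summable_qBinomial (ω * q) hq hqω).of_norm
  rw [hs.tsum_prod, hs.prod.tsum_eq_zero_add]
  simp only [tsum_multisetCrank_succ hω hq, pow_zero, one_mul, tsum_multisetCrank_zero hω hq]
  rw [tsum_mul_left]
  -- Partitions with ones supply the terms `n ≥ 1` of this q-binomial series; those without ones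
  -- supply the term `n = 0`.
  rw [hbs.tsum_eq_zero_add] at hb
  simp only [qPoch, Finset.prod_range_zero, pow_zero, div_one, mul_one] at hb
  simp only [qPoch]
  rw [← sub_eq_iff_eq_add'.2 hb.symm]
  have h1 : ω * q * (q / ω) = q * q := by field_simp
  have h2 := qPochInf_eq_mul q hq
  have hX := qPochInf_ne_zero hωq hq
  have hY := qPochInf_ne_zero hqω hq
  rw [h1, h2]
  field_simp
  ring

/-- The partition with `x.1` ones and the further parts `i + 2`, for `i ∈ x.2`. -/
def partitionOf (x : ℕ × Multiset ℕ) : Σ n : ℕ, n.Partition :=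
  ⟨(Multiset.replicate x.1 1 + x.2.map (· + 2)).sum,
    { parts := Multiset.replicate x.1 1 + x.2.map (· + 2)
      parts_pos := by
        intro i hi
        rcases Multiset.mem_add.1 hi with h | h
        · rw [Multiset.eq_of_mem_replicate h]; exact Nat.one_pos
        · obtain ⟨a, -, rfl⟩ := Multiset.mem_map.1 h
          exact Nat.succ_pos _
      parts_sum := rfl }⟩

lemma count_one_map_add_two (s : Multiset ℕ) : (s.map (· + 2)).count 1 = 0 := by
  refine Multiset.count_eq_zero_of_notMem fun h => ?_
  obtain ⟨a, -, h⟩ := Multiset.mem_map.1 h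
  omega

lemma partition_sigma_ext {x y : Σ n : ℕ, n.Partition} (h : x.2.parts = y.2.parts) : x = y := by
  obtain ⟨n, π⟩ := x
  obtain ⟨m, ρ⟩ := y
  have hnm : n = m := by rw [← π.parts_sum, ← ρ.parts_sum]; exact congrArg _ h
  subst hnm
  exact congrArg _ (Nat.Partition.ext h)

lemma partitionOf_bijective : Function.Bijective partitionOf := by
  constructor
  · rintro ⟨j, s⟩ ⟨j', s'⟩ h
    have hp : Multiset.replicate j 1 + s.map (· + 2) = Multiset.replicate j' 1 + s'.map (· + 2) :=
      congrArg (fun x : Σ n : ℕ, n.Partition => x.2.parts) h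
    have hc := congrArg (Multiset.count 1) hp
    simp only [Multiset.count_add, Multiset.count_replicate_self, count_one_map_add_two,
      add_zero] at hc
    subst hc
    have := Multiset.map_injective (add_left_injective 2) (add_left_cancel hp)
    rw [this]
  · intro x
    refine ⟨(x.2.parts.count 1, (x.2.parts.filter (· ≠ 1)).map (· - 2)), partition_sigma_ext ?_⟩
    have h1 : ((x.2.parts.filter (· ≠ 1)).map (· - 2)).map (· + 2) = x.2.parts.filter (· ≠ 1) := by
      rw [Multiset.map_map]
      conv_rhs => rw [← Multiset.map_id (x.2.parts.filter (· ≠ 1))]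
      refine Multiset.map_congr rfl fun a ha => ?_
      obtain ⟨ha, ha1⟩ := Multiset.mem_filter.1 ha
      have := x.2.parts_pos ha
      simp only [Function.comp, id]
      omega
    simp only [partitionOf]
    rw [h1, ← Multiset.filter_eq']
    exact Multiset.filter_add_not (· = 1) _

lemma crank_partitionOf (x : ℕ × Multiset ℕ) : crank (partitionOf x).2 = multisetCrank x.1 x.2 := by
  have hc : (partitionOf x).2.parts.count 1 = x.1 := by
    simp [partitionOf, Multiset.count_add]
  rw [crank, multisetCrank, hc]
  split_ifs with h
  · simp [partitionOf, h]
  · congr 2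
    simp only [partitionOf, Multiset.countP_add, Multiset.countP_map]
    rw [Multiset.countP_eq_zero.2 (fun a ha => by
      rw [Multiset.eq_of_mem_replicate ha]; omega), zero_add, Multiset.countP_eq_card_filter]

lemma pow_partitionOf (q : ℂ) (x : ℕ × Multiset ℕ) :
    q ^ (partitionOf x).1 = q ^ x.1 * (x.2.map (fun i => q ^ (i + 2))).prod := by
  simp only [partitionOf, Multiset.sum_add, Multiset.sum_replicate, smul_eq_mul, mul_one, pow_add]
  congr 1
  induction x.2 using Multiset.induction with
  | empty => simp
  | cons a s ih =>
    rw [Multiset.map_cons, Multiset.sum_cons, Multiset.map_cons, Multiset.prod_cons, pow_add, ih, pow_add]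

lemma summable_crank {ω q : ℂ} (hω : ‖ω‖ = 1) (hq : ‖q‖ < 1) :
    Summable fun x : Σ n : ℕ, n.Partition => ω ^ crank x.2 * q ^ x.1 := by
  rw [← (Equiv.ofBijective _ partitionOf_bijective).summable_iff]
  refine (summable_multisetCrank hω hq).congr fun x => ?_
  simp [crank_partitionOf, pow_partitionOf]

lemma tsum_crank {ω q : ℂ} (hω : ‖ω‖ = 1) (hq : ‖q‖ < 1) :
    ∑' x : Σ n : ℕ, n.Partition, ω ^ crank x.2 * q ^ x.1 =
      qPochInf q q / (qPochInf (ω * q) q * qPochInf (q / ω) q) + q - ω * q := by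
  rw [← tsum_multisetCrank hω hq, ← (Equiv.ofBijective _ partitionOf_bijective).tsum_eq]
  refine tsum_congr fun x => ?_
  simp [crank_partitionOf, pow_partitionOf]

/-- The coefficient `∑_{k<p} M(k,p,N) ω^k` of the crank generating function. -/
noncomputable def crankCoeff (p : ℕ) (ω : ℂ) (N : ℕ) : ℂ :=
  ∑ k ∈ Finset.range p, (crankCount k p N : ℂ) * ω ^ k

lemma sum_range_modEq {p : ℕ} (hp : 0 < p) {ω : ℂ} (hω : ω ^ p = 1) (m : ℤ) :
    ∑ k ∈ Finset.range p, (if m ≡ (k : ℤ) [ZMOD (p : ℤ)] then ω ^ k else 0) = ω ^ m := by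
  have hω0 : ω ≠ 0 := by rintro rfl; rw [zero_pow hp.ne'] at hω; exact zero_ne_one hω
  have hp' : (0 : ℤ) < p := by exact_mod_cast hp
  have h0 := Int.emod_nonneg m hp'.ne'
  have h1 := Int.emod_lt_of_pos m hp'
  rw [Finset.sum_eq_single (m % p).toNat]
  · have h2 : ((m % p).toNat : ℤ) = m % p := Int.toNat_of_nonneg h0
    rw [if_pos (by rw [h2]; exact (Int.mod_modEq m p).symm)]
    rw [← zpow_natCast, h2]
    conv_rhs => rw [← Int.emod_add_mul_ediv m p, zpow_add₀ hω0, zpow_mul, zpow_natCast, hω,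
      one_zpow, mul_one]
  · intro k hk hne
    have hk' := Finset.mem_range.1 hk
    rw [if_neg]
    intro h
    apply hne
    have h3 : m % p = (k : ℤ) % p := h
    rw [h3, Int.emod_eq_of_lt (by omega) (by omega)]
    simp
  · intro h
    exact absurd (Finset.mem_range.2 (by omega)) h

lemma crankCoeff_eq {p : ℕ} (hp : 0 < p) {ω : ℂ} (hω : ω ^ p = 1) {N : ℕ} (hN : N ≠ 1) :
    crankCoeff p ω N = ∑ π : N.Partition, ω ^ crank π := by
  simp only [crankCoeff, crankCount, if_neg hN]
  rw [Finset.sum_congr rfl fun π _ => (sum_range_modEq hp hω (crank π)).symm, Finset.sum_comm]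
  refine Finset.sum_congr rfl fun k _ => ?_
  rw [← Finset.sum_filter, Finset.sum_const, nsmul_eq_mul]
  simp

lemma crankCoeff_one {p : ℕ} (hp : 0 < p) {ω : ℂ} (hω : ω ^ p = 1) :
    crankCoeff p ω 1 = ω⁻¹ - 1 + ω := by
  have h : ∀ k : ℕ, (crankCount k p 1 : ℂ) * ω ^ k = ∑ m ∈ ({-1, 0, 1} : Finset ℤ),
      (if m = 0 then -1 else 1) * (if m ≡ (k : ℤ) [ZMOD (p : ℤ)] then ω ^ k else 0) := by
    intro k
    rw [crankCount, if_pos rfl, Int.cast_sum, Finset.sum_mul, Finset.sum_filter]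
    refine Finset.sum_congr rfl fun m _ => ?_
    split_ifs <;> simp
  simp only [crankCoeff, h]
  rw [Finset.sum_comm]
  simp only [← Finset.mul_sum, sum_range_modEq hp hω]
  rw [Finset.sum_insert (by decide), Finset.sum_insert (by decide), Finset.sum_singleton]
  simp
  ring

lemma sum_crank_partition_one (ω : ℂ) : ∑ π : (1 : ℕ).Partition, ω ^ crank π = ω⁻¹ := by
  rw [Fintype.sum_unique]
  have h : Multiset.countP (fun x => 1 < x) ({1} : Multiset ℕ) = 0 := by decide
  simp [crank, h]

/-- The only partition of `1` has crank `-1` and contributes `ω⁻¹`, while the convention prescribes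
`ω⁻¹ - 1 + ω`. The discrepancy `(ω - 1) q` is what cancels the stray degree-one term of
`tsum_crank`. -/
lemma crankCoeff_mul_pow {p : ℕ} (hp : 0 < p) {ω : ℂ} (hω : ω ^ p = 1) (q : ℂ) (N : ℕ) :
    crankCoeff p ω N * q ^ N = ∑' π : N.Partition, ω ^ crank π * q ^ N +
      if N = 1 then (ω - 1) * q else 0 := by
  rw [tsum_fintype, ← Finset.sum_mul]
  split_ifs with h
  · subst h
    rw [crankCoeff_one hp hω, sum_crank_partition_one]
    ring
  · rw [crankCoeff_eq hp hω h, add_zero]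

lemma norm_eq_one_of_pow {p : ℕ} (hp : 0 < p) {ω : ℂ} (hω : ω ^ p = 1) : ‖ω‖ = 1 :=
  Complex.norm_eq_one_of_pow_eq_one hω hp.ne'

lemma summable_crankCoeff {p : ℕ} (hp : 0 < p) {ω : ℂ} (hω : ω ^ p = 1) {q : ℂ} (hq : ‖q‖ < 1) :
    Summable fun N => crankCoeff p ω N * q ^ N := by
  have h := (summable_crank (norm_eq_one_of_pow hp hω) hq).sigma
  simp only [crankCoeff_mul_pow hp hω]
  exact h.add (hasSum_ite_eq 1 _).summable

/-- The Andrews-Garvan generating function of the crank. -/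
theorem tsum_crankCoeff {p : ℕ} (hp : 0 < p) {ω : ℂ} (hω : ω ^ p = 1) {q : ℂ} (hq : ‖q‖ < 1) :
    ∑' N, crankCoeff p ω N * q ^ N =
      qPochInf q q / (qPochInf (ω * q) q * qPochInf (q / ω) q) := by
  have hs := summable_crank (norm_eq_one_of_pow hp hω) hq
  simp only [crankCoeff_mul_pow hp hω]
  rw [hs.sigma.tsum_add (hasSum_ite_eq 1 _).summable, tsum_ite_eq, ← hs.tsum_sigma,
    tsum_crank (norm_eq_one_of_pow hp hω) hq]
  ring

/-! ### The Jacobi triple product -/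

/-- The reciprocal `1/(Q;Q)_n`, extended by zero to negative `n`. -/
noncomputable def qFactInv (Q : ℂ) (n : ℤ) : ℂ := if n < 0 then 0 else (qPoch Q Q n.toNat)⁻¹

lemma qFactInv_sub_one {Q : ℂ} (hQ : ‖Q‖ < 1) (n : ℤ) :
    qFactInv Q (n - 1) = (1 - Q ^ n) * qFactInv Q n := by
  rcases lt_trichotomy n 0 with h | h | h
  · rw [qFactInv, qFactInv, if_pos (by omega), if_pos h, mul_zero]
  · subst h
    simp [qFactInv]
  · obtain ⟨m, rfl⟩ : ∃ m : ℕ, n = (m : ℤ) + 1 := ⟨(n - 1).toNat, by omega⟩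
    have hne := qPoch_ne_zero hQ hQ (m + 1)
    rw [qFactInv, qFactInv, if_neg (by omega), if_neg (by omega)]
    have e1 : ((m : ℤ) + 1 - 1).toNat = m := by omega
    have e2 : ((m : ℤ) + 1).toNat = m + 1 := by omega
    have e3 : Q ^ ((m : ℤ) + 1) = Q * Q ^ m := by
      rw [show (m : ℤ) + 1 = ((m + 1 : ℕ) : ℤ) by push_cast; ring, zpow_natCast, pow_succ']
    rw [e1, e2, e3]
    rw [qPoch_succ] at hne ⊢
    have ha := left_ne_zero_of_mul hne
    have hb := right_ne_zero_of_mul hne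
    generalize qPoch Q Q m = A at *
    generalize Q * Q ^ m = B at *
    field_simp

lemma tendsto_qFactInv {Q : ℂ} (hQ : ‖Q‖ < 1) {f : ℕ → ℤ} (hf : Tendsto f atTop atTop) :
    Tendsto (fun N => qFactInv Q (f N)) atTop (𝓝 (qPochInf Q Q)⁻¹) := by
  have h1 : Tendsto (fun N => (f N).toNat) atTop atTop := by
    refine tendsto_atTop.2 fun b => ?_
    filter_upwards [hf.eventually_ge_atTop (b : ℤ)] with N hN
    omega
  have h2 := ((tendsto_qPoch Q hQ).comp h1).inv₀ (qPochInf_ne_zero hQ hQ)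
  refine h2.congr' ?_
  filter_upwards [hf.eventually_ge_atTop 0] with N hN
  rw [qFactInv, if_neg (by omega)]
  rfl

lemma exists_norm_qFactInv_le {Q : ℂ} (hQ : ‖Q‖ < 1) : ∃ C : ℝ, 0 ≤ C ∧ ∀ n, ‖qFactInv Q n‖ ≤ C := by
  have h := ((tendsto_qPoch Q hQ).inv₀ (qPochInf_ne_zero hQ hQ)).norm
  obtain ⟨C, hC⟩ := h.bddAbove_range
  have hC0 : 0 ≤ C := (norm_nonneg _).trans (hC ⟨0, rfl⟩)
  refine ⟨C, hC0, fun n => ?_⟩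
  rw [qFactInv]
  split_ifs with h
  · simpa using hC0
  · exact hC ⟨n.toNat, rfl⟩

/-- The finite form with Gaussian binomials `[2N choose N+n]` in base `h²`. Extending `1/(Q;Q)_n` by
zero makes the sum over all integers finite and keeps `qFactInv_sub_one` valid at the ends of the
range. -/
lemma hasSum_finite_tripleProduct {x h : ℂ} (hx : x ≠ 0) (h0 : h ≠ 0) (hh : ‖h ^ 2‖ < 1) (N : ℕ) :
    HasSum (fun n : ℤ => qPoch (h ^ 2) (h ^ 2) (2 * N) * qFactInv (h ^ 2) (N - n) *
        qFactInv (h ^ 2) (N + n) * (x ^ n * h ^ (n ^ 2)))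
      (qPoch (-(x * h)) (h ^ 2) N * qPoch (-(h / x)) (h ^ 2) N) := by
  have hQ0 : h ^ 2 ≠ 0 := pow_ne_zero 2 h0
  induction N with
  | zero =>
    have e : (fun n : ℤ => qPoch (h ^ 2) (h ^ 2) (2 * 0) * qFactInv (h ^ 2) ((0 : ℕ) - n) *
        qFactInv (h ^ 2) ((0 : ℕ) + n) * (x ^ n * h ^ (n ^ 2))) = fun n => if n = 0 then 1 else 0 := by
      funext n
      rcases lt_trichotomy n 0 with hn | hn | hn
      · have : qFactInv (h ^ 2) ((0 : ℕ) + n) = 0 := by rw [qFactInv, if_pos (by omega)]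
        rw [this, if_neg hn.ne]
        ring
      · subst hn
        simp [qFactInv, qPoch]
      · have : qFactInv (h ^ 2) ((0 : ℕ) - n) = 0 := by rw [qFactInv, if_pos (by omega)]
        rw [this, if_neg hn.ne']
        ring
    rw [e]
    simpa [qPoch] using hasSum_ite_eq (0 : ℤ) (1 : ℂ)
  | succ N ih =>
    have ih1 := (Equiv.subRight (1 : ℤ)).hasSum_iff.2 ih
    have ih2 := (Equiv.addRight (1 : ℤ)).hasSum_iff.2 ih
    have key := (ih.mul_left (1 + h ^ 2 * (h ^ 2) ^ (2 * N))).add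
      ((ih1.mul_left (h * (h ^ 2) ^ N * x)).add (ih2.mul_left (h * (h ^ 2) ^ N * x⁻¹)))
    -- Expanding `(1 + x h^(2N+1)) (1 + h^(2N+1)/x)` gives the constant term and the two index
    -- shifts combined in `key`.
    have hv : (1 + h ^ 2 * (h ^ 2) ^ (2 * N)) *
          (qPoch (-(x * h)) (h ^ 2) N * qPoch (-(h / x)) (h ^ 2) N) +
        (h * (h ^ 2) ^ N * x * (qPoch (-(x * h)) (h ^ 2) N * qPoch (-(h / x)) (h ^ 2) N) +
          h * (h ^ 2) ^ N * x⁻¹ * (qPoch (-(x * h)) (h ^ 2) N * qPoch (-(h / x)) (h ^ 2) N)) =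
        qPoch (-(x * h)) (h ^ 2) (N + 1) * qPoch (-(h / x)) (h ^ 2) (N + 1) := by
      rw [qPoch_succ, qPoch_succ, mul_comm 2 N, pow_mul _ N 2]
      generalize qPoch (-(x * h)) (h ^ 2) N = A
      generalize qPoch (-(h / x)) (h ^ 2) N = B
      generalize (h ^ 2) ^ N = C
      field_simp
      ring
    rw [hv] at key
    refine (congrArg (HasSum · _) (funext fun n => ?_)).mpr key
    simp only [Function.comp, Equiv.subRight_apply, Equiv.coe_addRight]
    have e1 := qFactInv_sub_one hh ((N : ℤ) + 1 - n)
    have e2 := qFactInv_sub_one hh ((N : ℤ) + 1 + n)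
    have e3 := qFactInv_sub_one hh ((N : ℤ) - n)
    have e4 := qFactInv_sub_one hh ((N : ℤ) + n)
    rw [show (N : ℤ) + 1 - n - 1 = N - n by ring] at e1
    rw [show (N : ℤ) + 1 + n - 1 = N + n by ring] at e2
    have t1 : (N : ℤ) - (n - 1) = N + 1 - n := by ring
    have t2 : (N : ℤ) + (n - 1) = N + n - 1 := by ring
    have t3 : (N : ℤ) - (n + 1) = N - n - 1 := by ring
    have t4 : (N : ℤ) + (n + 1) = N + 1 + n := by ring
    rw [t1, t2, t3, t4, e3, e4, e1, e2]
    push_cast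
    have p1 : qPoch (h ^ 2) (h ^ 2) (2 * (N + 1)) = qPoch (h ^ 2) (h ^ 2) (2 * N) *
        (1 - h ^ 2 * (h ^ 2) ^ (2 * N)) * (1 - h ^ 2 * (h ^ 2) ^ (2 * N + 1)) := by
      rw [show 2 * (N + 1) = 2 * N + 1 + 1 by ring, qPoch_succ, qPoch_succ]
    set a := (h ^ 2) ^ ((N : ℤ) - n) with ha
    set b := (h ^ 2) ^ ((N : ℤ) + n) with hb
    have ha' : (h ^ 2) ^ ((N : ℤ) + 1 - n) = h ^ 2 * a := by
      rw [ha, show (N : ℤ) + 1 - n = 1 + (N - n) by ring, zpow_add₀ hQ0, zpow_one]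
    have hb' : (h ^ 2) ^ ((N : ℤ) + 1 + n) = h ^ 2 * b := by
      rw [hb, show (N : ℤ) + 1 + n = 1 + (N + n) by ring, zpow_add₀ hQ0, zpow_one]
    have hab : (h ^ 2) ^ (2 * N) = a * b := by
      rw [ha, hb, ← zpow_add₀ hQ0, show (N : ℤ) - n + (N + n) = ((2 * N : ℕ) : ℤ) by push_cast; ring,
        zpow_natCast]
    have x1 : h * (h ^ 2) ^ N * x * (x ^ (n - 1) * h ^ ((n - 1) ^ 2)) =
        h ^ 2 * a * (x ^ n * h ^ (n ^ 2)) := by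
      rw [zpow_sub_one₀ hx, show (n - 1) ^ 2 = n ^ 2 + (-2 * n + 1) by ring, zpow_add₀ h0,
        zpow_add_one₀ h0, ha, zpow_sub₀ hQ0, zpow_natCast, zpow_mul]
      have : (h ^ (-2 : ℤ)) ^ n = ((h ^ 2) ^ n)⁻¹ := by
        rw [zpow_neg, inv_zpow]; rfl
      rw [this]
      field_simp
    have x2 : h * (h ^ 2) ^ N * x⁻¹ * (x ^ (n + 1) * h ^ ((n + 1) ^ 2)) =
        h ^ 2 * b * (x ^ n * h ^ (n ^ 2)) := by
      rw [zpow_add_one₀ hx, show (n + 1) ^ 2 = n ^ 2 + (2 * n + 1) by ring, zpow_add₀ h0,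
        zpow_add_one₀ h0, hb, zpow_add₀ hQ0, zpow_natCast, zpow_mul]
      have : (h ^ (2 : ℤ)) ^ n = (h ^ 2) ^ n := rfl
      rw [this]
      field_simp
    rw [p1, pow_succ (h ^ 2) (2 * N), hab, ha', hb']
    generalize qFactInv (h ^ 2) ((N : ℤ) + 1 - n) = E₁
    generalize qFactInv (h ^ 2) ((N : ℤ) + 1 + n) = E₂
    generalize qPoch (h ^ 2) (h ^ 2) (2 * N) = P
    linear_combination (-(P * E₁ * ((1 - b) * ((1 - h ^ 2 * b) * E₂)))) * x1 -
      (P * ((1 - a) * ((1 - h ^ 2 * a) * E₁)) * E₂) * x2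

/-- The Jacobi triple product identity. -/
theorem tripleProduct {x h : ℂ} (hx : x ≠ 0) (h0 : h ≠ 0) (hh : ‖h ^ 2‖ < 1)
    (hs : Summable fun n : ℤ => x ^ n * h ^ (n ^ 2)) :
    ∑' n : ℤ, x ^ n * h ^ (n ^ 2) = qPochInf (h ^ 2) (h ^ 2) *
      (qPochInf (-(x * h)) (h ^ 2) * qPochInf (-(h / x)) (h ^ 2)) := by
  set Q := h ^ 2 with hQdef
  obtain ⟨C, hC0, hC⟩ := exists_norm_qFactInv_le hh
  obtain ⟨D, hD⟩ := (tendsto_qPoch Q hh).norm.bddAbove_range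
  have hD' : ∀ n, ‖qPoch Q Q n‖ ≤ D := fun n => hD ⟨n, rfl⟩
  have hD0 : 0 ≤ D := (norm_nonneg _).trans (hD' 0)
  have hne := qPochInf_ne_zero hh hh
  -- The Gaussian binomials are bounded uniformly in `N` and `n` and tend to `1/(Q;Q)_∞` for fixed
  -- `n`, so the limit passes under the sum.
  have hlim : Tendsto (fun N : ℕ => ∑' n : ℤ, qPoch Q Q (2 * N) * qFactInv Q (N - n) *
      qFactInv Q (N + n) * (x ^ n * h ^ (n ^ 2))) atTop
      (𝓝 (∑' n : ℤ, (qPochInf Q Q)⁻¹ * (x ^ n * h ^ (n ^ 2)))) := by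
    refine tendsto_tsum_of_dominated_convergence (hs.norm.mul_left (D * C * C)) (fun n => ?_)
      (Eventually.of_forall fun N n => ?_)
    · have h1 : Tendsto (fun N : ℕ => qPoch Q Q (2 * N)) atTop (𝓝 (qPochInf Q Q)) :=
        (tendsto_qPoch Q hh).comp (tendsto_id.const_mul_atTop' (by norm_num))
      have h2 : Tendsto (fun N : ℕ => qFactInv Q (N - n)) atTop (𝓝 (qPochInf Q Q)⁻¹) :=
        tendsto_qFactInv hh (tendsto_atTop_add_const_right _ (-n) tendsto_natCast_atTop_atTop)
      have h3 : Tendsto (fun N : ℕ => qFactInv Q (N + n)) atTop (𝓝 (qPochInf Q Q)⁻¹) :=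
        tendsto_qFactInv hh (tendsto_atTop_add_const_right _ n tendsto_natCast_atTop_atTop)
      have h4 := ((h1.mul h2).mul h3).mul_const (x ^ n * h ^ (n ^ 2))
      rwa [mul_inv_cancel₀ hne, one_mul] at h4
    · rw [norm_mul, norm_mul, norm_mul]
      gcongr
      · exact hD' _
      · exact hC _
      · exact hC _
  have hlim2 := (tendsto_qPoch (-(x * h)) hh).mul (tendsto_qPoch (-(h / x)) hh)
  have := tendsto_nhds_unique (hlim.congr fun N => (hasSum_finite_tripleProduct hx h0 hh N).tsum_eq)
    hlim2
  rw [← this, tsum_mul_left, mul_inv_cancel_left₀ hne]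

/-! ### The theta quotient and its inversion formula -/

/-- `e(x) = exp(2πix)`. -/
noncomputable def expTwoPiI (x : ℂ) : ℂ := Complex.exp (2 * (Real.pi : ℂ) * Complex.I * x)

lemma expTwoPiI_add (x y : ℂ) : expTwoPiI (x + y) = expTwoPiI x * expTwoPiI y := by
  rw [expTwoPiI, mul_add, Complex.exp_add]; rfl

lemma expTwoPiI_ne_zero (x : ℂ) : expTwoPiI x ≠ 0 := Complex.exp_ne_zero _

lemma expTwoPiI_neg (x : ℂ) : expTwoPiI (-x) = (expTwoPiI x)⁻¹ := by
  rw [expTwoPiI, mul_neg, Complex.exp_neg]; rfl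

lemma expTwoPiI_zero : expTwoPiI 0 = 1 := by simp [expTwoPiI]

lemma expTwoPiI_half : expTwoPiI (1 / 2) = -1 := by
  rw [expTwoPiI, ← Complex.exp_pi_mul_I]; congr 1; ring

lemma expTwoPiI_intCast (n : ℤ) : expTwoPiI n = 1 := by
  rw [expTwoPiI, mul_comm, Complex.exp_int_mul_two_pi_mul_I]

lemma expTwoPiI_natCast (n : ℕ) : expTwoPiI n = 1 := by exact_mod_cast expTwoPiI_intCast n

lemma expTwoPiI_int_mul (n : ℤ) (x : ℂ) : expTwoPiI (n * x) = expTwoPiI x ^ n := by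
  rw [expTwoPiI, expTwoPiI, ← Complex.exp_int_mul]; congr 1; ring

lemma expTwoPiI_nat_mul (n : ℕ) (x : ℂ) : expTwoPiI (n * x) = expTwoPiI x ^ n := by
  exact_mod_cast expTwoPiI_int_mul n x

lemma nome_eq (τ : ℍ) : nome τ = expTwoPiI τ := rfl

lemma norm_nome_lt_one (τ : ℍ) : ‖nome τ‖ < 1 := UpperHalfPlane.norm_exp_two_pi_I_lt_one τ

lemma nome_ne_zero (τ : ℍ) : nome τ ≠ 0 := Complex.exp_ne_zero _

/-- The odd theta function divided by `η³`, as a product. -/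
noncomputable def thetaQuot (u : ℂ) (τ : ℍ) : ℂ :=
  (expTwoPiI (u / 2) - expTwoPiI (-u / 2)) *
    (qPochInf (expTwoPiI u * nome τ) (nome τ) * qPochInf (expTwoPiI (-u) * nome τ) (nome τ)) /
      qPochInf (nome τ) (nome τ) ^ 2

lemma thetaQuot_neg (u : ℂ) (τ : ℍ) : thetaQuot (-u) τ = -thetaQuot u τ := by
  simp only [thetaQuot, neg_neg]
  ring

lemma thetaQuot_add_one (u : ℂ) (τ : ℍ) : thetaQuot (u + 1) τ = -thetaQuot u τ := by
  have h1 : expTwoPiI (u + 1) = expTwoPiI u := by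
    rw [expTwoPiI_add]; simpa using congrArg (expTwoPiI u * ·) (expTwoPiI_natCast 1)
  have h2 : expTwoPiI (-(u + 1)) = expTwoPiI (-u) := by rw [expTwoPiI_neg, h1, expTwoPiI_neg]
  have h3 : expTwoPiI ((u + 1) / 2) = -expTwoPiI (u / 2) := by
    rw [add_div, expTwoPiI_add, expTwoPiI_half]; ring
  have h4 : expTwoPiI (-(u + 1) / 2) = -expTwoPiI (-u / 2) := by
    rw [neg_div, expTwoPiI_neg, h3, neg_div, expTwoPiI_neg, inv_neg]
  rw [thetaQuot, thetaQuot, h1, h2, h3, h4]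
  ring

lemma one_sub_expTwoPiI_neg (u : ℂ) :
    1 - expTwoPiI (-u) = expTwoPiI (-u / 2) * (expTwoPiI (u / 2) - expTwoPiI (-u / 2)) := by
  rw [mul_sub, ← expTwoPiI_add, ← expTwoPiI_add]
  rw [show -u / 2 + u / 2 = 0 by ring, show -u / 2 + -u / 2 = -u by ring, expTwoPiI_zero]

lemma thetaQuot_add_self (u : ℂ) (τ : ℍ) :
    thetaQuot (u + τ) τ = -expTwoPiI (-u - τ / 2) * thetaQuot u τ := by
  have hq := norm_nome_lt_one τ
  have h1 : expTwoPiI (u + τ) = expTwoPiI u * nome τ := expTwoPiI_add _ _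
  have h2 : expTwoPiI (-(u + τ)) * nome τ = expTwoPiI (-u) := by
    rw [expTwoPiI_neg, h1, expTwoPiI_neg, mul_inv, mul_assoc, inv_mul_cancel₀ (nome_ne_zero τ),
      mul_one]
  have h3 := qPochInf_eq_mul (expTwoPiI u * nome τ) hq
  have h4 := qPochInf_eq_mul (expTwoPiI (-u)) hq
  have h5 : expTwoPiI ((u + τ) / 2) - expTwoPiI (-(u + τ) / 2) =
      -expTwoPiI (-u / 2 - τ / 2) * (1 - expTwoPiI u * nome τ) := by
    rw [← h1, neg_mul, mul_sub, ← expTwoPiI_add, mul_one]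
    ring_nf
  have h6 : expTwoPiI (-u - τ / 2) = expTwoPiI (-u / 2 - τ / 2) * expTwoPiI (-u / 2) := by
    rw [← expTwoPiI_add]; ring_nf
  rw [thetaQuot, thetaQuot, h2, h1, h3, h4, h5, one_sub_expTwoPiI_neg, h6]
  ring

/-- Shifting by the half period `1/2 + τ/2` moves the zero of the theta function to `u = 0`; the
triple product then yields the factors of `thetaQuot`. -/
lemma jacobiTheta₂_eq_thetaQuot (u : ℂ) (τ : ℍ) :
    jacobiTheta₂ (u + 1 / 2 + τ / 2) τ =
      qPochInf (nome τ) (nome τ) ^ 3 * expTwoPiI (-u / 2) * thetaQuot u τ := by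
  have hq := norm_nome_lt_one τ
  set x := expTwoPiI (u + 1 / 2 + τ / 2) with hx
  set h := expTwoPiI ((τ : ℂ) / 2) with hh
  have hx0 : x ≠ 0 := expTwoPiI_ne_zero _
  have h0 : h ≠ 0 := expTwoPiI_ne_zero _
  have hsq : h ^ 2 = nome τ := by
    rw [hh, ← expTwoPiI_nat_mul, nome_eq]; congr 1; push_cast; ring
  have hterm : ∀ n : ℤ, jacobiTheta₂_term n (u + 1 / 2 + τ / 2) τ = x ^ n * h ^ (n ^ 2) := by
    intro n
    rw [hx, hh, ← expTwoPiI_int_mul, ← expTwoPiI_int_mul, ← expTwoPiI_add, jacobiTheta₂_term,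
      expTwoPiI]
    congr 1
    push_cast
    ring
  have hs := (summable_jacobiTheta₂_term_iff (u + 1 / 2 + τ / 2) τ).2 τ.im_pos
  simp only [hterm] at hs
  have ht := tripleProduct hx0 h0 (by rwa [hsq]) hs
  have hxe : x = -expTwoPiI u * h := by
    rw [hx, expTwoPiI_add, expTwoPiI_add, expTwoPiI_half]; ring
  have e1 : -(x * h) = expTwoPiI u * nome τ := by rw [hxe, ← hsq]; ring
  have e2 : -(h / x) = expTwoPiI (-u) := by
    rw [hxe, expTwoPiI_neg]
    have := expTwoPiI_ne_zero u
    field_simp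
  rw [jacobiTheta₂, tsum_congr hterm, ht, e1, e2, hsq, qPochInf_eq_mul (expTwoPiI (-u)) hq,
    one_sub_expTwoPiI_neg, thetaQuot]
  have hne := qPochInf_ne_zero hq hq
  field_simp

lemma tendsto_qPochInf {q : ℂ} (hq : ‖q‖ < 1) (a : ℂ) :
    Tendsto (fun b => qPochInf b q) (𝓝 a) (𝓝 (qPochInf a q)) := by
  simp only [qPochInf, sub_eq_add_neg]
  have hs : Summable fun i : ℕ => (‖a‖ + 1) * ‖q‖ ^ i :=
    (summable_geometric_of_lt_one (norm_nonneg q) hq).mul_left _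
  refine tendsto_tprod_one_add_of_dominated_convergence hs (fun k => ?_) ?_
  · exact (tendsto_id.mul_const _).neg
  · have h1 : ∀ᶠ b in 𝓝 a, ‖b‖ < ‖a‖ + 1 :=
      (continuous_norm.tendsto a).eventually_lt_const (lt_add_one _)
    filter_upwards [h1] with b hb k
    rw [norm_neg, norm_mul, norm_pow]
    gcongr

/-- The limit does not depend on `τ`; this is what division by `η³` achieves, and it fixes the
constant in `thetaQuot_S`. -/
lemma tendsto_thetaQuot_div (τ : ℍ) :
    Tendsto (fun u => thetaQuot u τ / u) (𝓝[≠] 0) (𝓝 (2 * Real.pi * Complex.I)) := by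
  have hq := norm_nome_lt_one τ
  have hne := qPochInf_ne_zero hq hq
  have hd : HasDerivAt (fun u : ℂ => expTwoPiI (u / 2) - expTwoPiI (-u / 2))
      (2 * Real.pi * Complex.I) 0 := by
    have h1 : HasDerivAt (fun u : ℂ => 2 * (Real.pi : ℂ) * Complex.I * (u / 2))
        (2 * (Real.pi : ℂ) * Complex.I * (1 / 2)) 0 :=
      ((hasDerivAt_id (0 : ℂ)).div_const 2).const_mul _
    have h2 : HasDerivAt (fun u : ℂ => 2 * (Real.pi : ℂ) * Complex.I * (-u / 2))
        (2 * (Real.pi : ℂ) * Complex.I * (-1 / 2)) 0 :=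
      (((hasDerivAt_id (0 : ℂ)).neg).div_const 2).const_mul _
    have h3 := h1.cexp.sub h2.cexp
    refine h3.congr_deriv ?_
    simp
    ring
  have h1 := hasDerivAt_iff_tendsto_slope.1 hd
  have hc : ∀ c : ℂ, Tendsto (fun u : ℂ => qPochInf (expTwoPiI (c * u) * nome τ) (nome τ)) (𝓝[≠] 0)
      (𝓝 (qPochInf (nome τ) (nome τ))) := by
    intro c
    have hcont : Continuous fun u : ℂ => expTwoPiI (c * u) * nome τ := by
      unfold expTwoPiI
      fun_prop
    have h2 := hcont.tendsto 0
    simp only [mul_zero, expTwoPiI_zero, one_mul] at h2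
    exact ((tendsto_qPochInf hq _).comp h2).mono_left nhdsWithin_le_nhds
  have h2 := (h1.mul ((hc 1).mul (hc (-1)))).div_const (qPochInf (nome τ) (nome τ) ^ 2)
  have h3 : 2 * Real.pi * Complex.I * (qPochInf (nome τ) (nome τ) * qPochInf (nome τ) (nome τ)) /
      qPochInf (nome τ) (nome τ) ^ 2 = 2 * Real.pi * Complex.I := by
    field_simp
  rw [h3] at h2
  refine h2.congr fun u => ?_
  simp only [slope_def_field, thetaQuot, one_mul, neg_mul, zero_div, neg_zero, expTwoPiI_zero,
    sub_self, sub_zero]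
  ring

/-- The functional equation of `jacobiTheta₂` determines the dependence on `u`. All Euler products
and the square root of `-iτ` go into a constant `c` independent of `u`, so the transformation of `η`
is not needed. -/
lemma exists_thetaQuot_S (τ : ℍ) : ∃ c : ℂ, ∀ u : ℂ,
    thetaQuot (u / τ) (ModularGroup.S • τ) = c * (expTwoPiI (u ^ 2 / (2 * τ)) * thetaQuot u τ) := by
  have hτ : (τ : ℂ) ≠ 0 := τ.ne_zero
  set τ' := ModularGroup.S • τ with hτ'
  have hτ'e : (τ' : ℂ) = -1 / τ := by
    rw [hτ', UpperHalfPlane.modular_S_smul]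
    simp [neg_div, inv_neg]
  have hq := norm_nome_lt_one τ'
  have hne := qPochInf_ne_zero hq hq
  set κ : ℂ := 1 / (-Complex.I * τ) ^ (1 / 2 : ℂ) with hκ
  have hκ0 : κ ≠ 0 := by
    rw [hκ, one_div]
    refine inv_ne_zero fun h => ?_
    rw [Complex.cpow_eq_zero_iff] at h
    simp [hτ] at h
  refine ⟨(qPochInf (nome τ') (nome τ') ^ 3)⁻¹ * κ⁻¹ * qPochInf (nome τ) (nome τ) ^ 3 *
    expTwoPiI ((1 / τ - (1 + τ) / τ + (1 + τ) ^ 2 / (4 * τ)) / 2), fun u => ?_⟩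
  have e1 := jacobiTheta₂_eq_thetaQuot u τ
  have e2 := jacobiTheta₂_eq_thetaQuot (u / τ) τ'
  have e3 := jacobiTheta₂_functional_equation (u + 1 / 2 + τ / 2) τ
  have e4 := jacobiTheta₂_add_left' ((u + 1 / 2 + τ / 2) / τ) τ'
  -- The shifted points on the two sides differ by the full period `τ'`, hence the appeal to
  -- quasi-periodicity in `e4`.
  have e5 : u / τ + 1 / 2 + τ' / 2 = (u + 1 / 2 + τ / 2) / τ + τ' := by
    rw [hτ'e]; field_simp; ring
  rw [← e5, e2] at e4
  rw [e1, ← hτ'e, ← hκ] at e3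
  set J := jacobiTheta₂ ((u + 1 / 2 + τ / 2) / τ) τ'
  set A := expTwoPiI (-(u / τ) / 2) with hA
  set B := expTwoPiI (-u / 2) with hB
  have hA0 : A ≠ 0 := expTwoPiI_ne_zero _
  have hE : Complex.exp (-Real.pi * Complex.I * (u + 1 / 2 + τ / 2) ^ 2 / τ) ≠ 0 :=
    Complex.exp_ne_zero _
  have key : A * expTwoPiI ((1 / τ - (1 + τ) / τ + (1 + τ) ^ 2 / (4 * τ)) / 2) *
      expTwoPiI (u ^ 2 / (2 * τ)) * Complex.exp (-Real.pi * Complex.I * (u + 1 / 2 + τ / 2) ^ 2 / τ) =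
      Complex.exp (-Real.pi * Complex.I * (τ' + 2 * ((u + 1 / 2 + τ / 2) / τ))) * B := by
    rw [hA, hB, hτ'e]
    simp only [expTwoPiI, ← Complex.exp_add]
    congr 1
    field_simp
    ring
  set E₁ := Complex.exp (-Real.pi * Complex.I * (u + 1 / 2 + τ / 2) ^ 2 / τ)
  set E₂ := Complex.exp (-Real.pi * Complex.I * (τ' + 2 * ((u + 1 / 2 + τ / 2) / τ)))
  set E₃ := expTwoPiI ((1 / τ - (1 + τ) / τ + (1 + τ) ^ 2 / (4 * τ)) / 2)
  set E₄ := expTwoPiI (u ^ 2 / (2 * τ))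
  set R := qPochInf (nome τ') (nome τ') ^ 3
  set R' := qPochInf (nome τ) (nome τ) ^ 3
  have hR : R ≠ 0 := pow_ne_zero 3 hne
  have hgoal : R * A * κ * E₁ * thetaQuot (u / τ) τ' = A * E₁ * R' * E₃ * E₄ * thetaQuot u τ := by
    linear_combination κ * E₁ * e4 - E₂ * e3 - R' * thetaQuot u τ * key
  field_simp
  apply mul_left_cancel₀ (mul_ne_zero hA0 hE)
  linear_combination hgoal

lemma thetaQuot_S (u : ℂ) (τ : ℍ) :
    thetaQuot (u / τ) (ModularGroup.S • τ) =
      (τ : ℂ)⁻¹ * (expTwoPiI (u ^ 2 / (2 * τ)) * thetaQuot u τ) := by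
  have hτ : (τ : ℂ) ≠ 0 := τ.ne_zero
  obtain ⟨c, hc⟩ := exists_thetaQuot_S τ
  have hpi : 2 * (Real.pi : ℂ) * Complex.I ≠ 0 := Complex.two_pi_I_ne_zero
  have h1 : Tendsto (fun u : ℂ => u / τ) (𝓝[≠] 0) (𝓝[≠] 0) := by
    refine tendsto_nhdsWithin_iff.2 ⟨?_, ?_⟩
    · have : Continuous fun u : ℂ => u / (τ : ℂ) := by fun_prop
      simpa using (this.tendsto 0).mono_left nhdsWithin_le_nhds
    · filter_upwards [self_mem_nhdsWithin] with u hu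
      exact div_ne_zero hu hτ
  have h2 := ((tendsto_thetaQuot_div (ModularGroup.S • τ)).comp h1).mul_const (τ : ℂ)⁻¹
  have h3 : Tendsto (fun u : ℂ => expTwoPiI (u ^ 2 / (2 * τ))) (𝓝[≠] 0) (𝓝 1) := by
    have : Continuous fun u : ℂ => expTwoPiI (u ^ 2 / (2 * τ)) := by
      unfold expTwoPiI; fun_prop
    simpa [expTwoPiI_zero] using (this.tendsto 0).mono_left nhdsWithin_le_nhds
  have h4 := (h3.mul (tendsto_thetaQuot_div τ)).const_mul c
  -- Dividing by `u` and letting `u → 0` evaluates the unknown constant as `1/τ`.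
  have h5 := tendsto_nhds_unique (h2.congr fun u => ?_) h4
  · have : c = (τ : ℂ)⁻¹ := by
      apply mul_left_cancel₀ hpi
      linear_combination -h5
    rw [hc, this]
  · simp only [Function.comp]
    rw [hc]
    by_cases hu : u = 0
    · simp [hu]
    · field_simp

/-! ### Klein forms -/

/-- The Klein form `e(r(rτ+s)/2) θ(rτ+s,τ)/η(τ)³`, up to a constant. -/
noncomputable def klein (r s : ℂ) (τ : ℍ) : ℂ :=
  expTwoPiI (r * (r * τ + s) / 2) * thetaQuot (r * τ + s) τ

lemma klein_slash_S (r s : ℂ) : klein r s ∣[(-1 : ℤ)] ModularGroup.S = klein s (-r) := by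
  ext τ
  have hτ : (τ : ℂ) ≠ 0 := τ.ne_zero
  have hτ'e : ((ModularGroup.S • τ : ℍ) : ℂ) = -1 / τ := by
    rw [UpperHalfPlane.modular_S_smul]
    simp [neg_div, inv_neg]
  have h := thetaQuot_S (s * τ + -r) τ
  have e1 : r * (-1 / (τ : ℂ)) + s = (s * τ + -r) / τ := by field_simp; ring
  rw [ModularForm.SL_slash_apply, ModularGroup.denom_S, klein, klein, hτ'e, e1, h, neg_neg, zpow_one]
  have e2 : expTwoPiI (r * ((s * τ + -r) / τ) / 2) * expTwoPiI ((s * τ + -r) ^ 2 / (2 * τ)) =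
      expTwoPiI (s * (s * τ + -r) / 2) := by
    rw [← expTwoPiI_add]; congr 1; field_simp; ring
  rw [← e2]
  field_simp

lemma nome_T (τ : ℍ) : nome (ModularGroup.T • τ) = nome τ := by
  rw [nome_eq, nome_eq, UpperHalfPlane.modular_T_smul, UpperHalfPlane.coe_vadd, expTwoPiI_add]
  simpa using congrArg (· * expTwoPiI τ) (expTwoPiI_natCast 1)

lemma klein_slash_T (r s : ℂ) : klein r s ∣[(-1 : ℤ)] ModularGroup.T = klein r (r + s) := by
  ext τ
  have hden : UpperHalfPlane.denom (ModularGroup.T : SL(2, ℤ)) τ = 1 := by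
    rw [ModularGroup.denom_apply]
    simp [ModularGroup.T]
  rw [ModularForm.SL_slash_apply, hden, one_zpow, mul_one, klein, klein, thetaQuot, thetaQuot, nome_T,
    UpperHalfPlane.modular_T_smul, UpperHalfPlane.coe_vadd]
  have : r * (((1 : ℝ) : ℂ) + τ) + s = r * τ + (r + s) := by push_cast; ring
  rw [this]

/-- The exponential prefactor absorbs the Gaussian factor of the inversion formula, so `S` and `T`
act exactly by right multiplication on the row `(r, s)`; since they generate, so does every matrix.
-/
theorem klein_slash (γ : SL(2, ℤ)) (r s : ℂ) :
    klein r s ∣[(-1 : ℤ)] γ =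
      klein (r * (γ 0 0 : ℤ) + s * (γ 1 0 : ℤ)) (r * (γ 0 1 : ℤ) + s * (γ 1 1 : ℤ)) := by
  have hmem : γ ∈ Subgroup.closure {ModularGroup.S, ModularGroup.T} := by
    rw [SpecialLinearGroup.SL2Z_generators]; trivial
  induction hmem using Subgroup.closure_induction generalizing r s with
  | mem x hx =>
    rcases hx with rfl | rfl
    · rw [klein_slash_S]; simp [ModularGroup.S]
    · rw [klein_slash_T]; simp [ModularGroup.T]
  | one => simp
  | mul x y _ _ hx hy =>
    rw [SlashAction.slash_mul, hx, hy]
    congr 1 <;>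
    · simp [Matrix.mul_apply, Fin.sum_univ_two]
      ring
  | inv x _ hx =>
    have hdet : ((x 0 0 : ℤ) : ℂ) * (x 1 1 : ℤ) - (x 0 1 : ℤ) * (x 1 0 : ℤ) = 1 := by
      have := Matrix.SpecialLinearGroup.det_coe x
      rw [Matrix.det_fin_two] at this
      exact_mod_cast this
    have h := hx (r * (x⁻¹ 0 0 : ℤ) + s * (x⁻¹ 1 0 : ℤ)) (r * (x⁻¹ 0 1 : ℤ) + s * (x⁻¹ 1 1 : ℤ))
    have i00 : x⁻¹ 0 0 = x 1 1 := by rw [Matrix.SpecialLinearGroup.SL2_inv_expl]; rfl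
    have i01 : x⁻¹ 0 1 = -x 0 1 := by rw [Matrix.SpecialLinearGroup.SL2_inv_expl]; rfl
    have i10 : x⁻¹ 1 0 = -x 1 0 := by rw [Matrix.SpecialLinearGroup.SL2_inv_expl]; rfl
    have i11 : x⁻¹ 1 1 = x 0 0 := by rw [Matrix.SpecialLinearGroup.SL2_inv_expl]; rfl
    rw [i00, i01, i10, i11, Int.cast_neg, Int.cast_neg] at h ⊢
    have e1 : (r * (x 1 1 : ℤ) + s * -(x 1 0 : ℤ)) * (x 0 0 : ℤ) +
        (r * -(x 0 1 : ℤ) + s * (x 0 0 : ℤ)) * (x 1 0 : ℤ) = r := by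
      linear_combination r * hdet
    have e2 : (r * (x 1 1 : ℤ) + s * -(x 1 0 : ℤ)) * (x 0 1 : ℤ) +
        (r * -(x 0 1 : ℤ) + s * (x 0 0 : ℤ)) * (x 1 1 : ℤ) = s := by
      linear_combination s * hdet
    rw [e1, e2] at h
    rw [← h, ← SlashAction.slash_mul, mul_inv_cancel, SlashAction.slash_one]

lemma klein_zero_left (s : ℂ) (τ : ℍ) : klein 0 s τ = thetaQuot s τ := by
  simp [klein, expTwoPiI_zero]

/-- Quasi-periodicity under `u ↦ u + τ` removes an integral first coordinate, leaving only an
explicit factor free of `τ`. -/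
lemma klein_natCast (n : ℕ) (s : ℂ) (τ : ℍ) :
    klein n s τ = (-1) ^ n * expTwoPiI (-(n * s / 2)) * thetaQuot s τ := by
  induction n with
  | zero => simp [klein_zero_left, expTwoPiI_zero]
  | succ n ih =>
    have h : klein (n + 1 : ℕ) s τ = -expTwoPiI (-(s / 2)) * klein n s τ := by
      have e : ((n + 1 : ℕ) : ℂ) * τ + s = (n * τ + s) + τ := by push_cast; ring
      rw [klein, klein, e, thetaQuot_add_self]
      have e2 : expTwoPiI (((n + 1 : ℕ) : ℂ) * (n * τ + s + τ) / 2) *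
          expTwoPiI (-(n * τ + s) - τ / 2) =
          expTwoPiI (-(s / 2)) * expTwoPiI (n * (n * τ + s) / 2) := by
        rw [← expTwoPiI_add, ← expTwoPiI_add]; congr 1; push_cast; ring
      linear_combination -thetaQuot (n * τ + s) τ * e2
    have e3 : expTwoPiI (-(((n + 1 : ℕ) : ℂ) * s / 2)) =
        expTwoPiI (-(s / 2)) * expTwoPiI (-(n * s / 2)) := by
      rw [← expTwoPiI_add]; congr 1; push_cast; ring
    rw [h, ih, e3]
    ring

/-- Transformation of `thetaQuot` at a division value under a matrix that preserves it. -/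
lemma thetaQuot_smul (γ : SL(2, ℤ)) (u : ℂ) (n : ℕ) (hn : u * (γ 1 0 : ℤ) = n) (τ : ℍ) :
    UpperHalfPlane.denom γ τ * thetaQuot u (γ • τ) =
      (-1) ^ n * expTwoPiI (-(n * (u * (γ 1 1 : ℤ)) / 2)) * thetaQuot (u * (γ 1 1 : ℤ)) τ := by
  have h := congrFun (klein_slash γ 0 u) τ
  rw [ModularForm.SL_slash_apply, klein_zero_left, zero_mul, zero_mul, zero_add, zero_add, hn,
    klein_natCast, neg_neg, zpow_one] at h
  rw [← h, mul_comm]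

/-- Only `ε ^ 2 = 1` and independence of `τ` are recorded: the same sign later occurs at both `τ`
and `pτ`, and only in the even power `p + 1`. -/
lemma thetaQuot_add_int (u : ℂ) (t : ℤ) : ∃ ε : ℂ, ε ^ 2 = 1 ∧
    ∀ τ : ℍ, thetaQuot (u + t) τ = ε * thetaQuot u τ := by
  have hnat : ∀ (n : ℕ) (u : ℂ) (τ : ℍ), thetaQuot (u + n) τ = (-1) ^ n * thetaQuot u τ := by
    intro n u τ
    induction n with
    | zero => simp
    | succ n ih =>
      rw [Nat.cast_succ, ← add_assoc, thetaQuot_add_one, ih]; ring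
  obtain ⟨n, rfl | rfl⟩ := t.eq_nat_or_neg
  · exact ⟨(-1) ^ n, by rw [← pow_mul, mul_comm, pow_mul]; simp, fun τ => by
      rw [Int.cast_natCast, hnat]⟩
  · refine ⟨(-1) ^ n, by rw [← pow_mul, mul_comm, pow_mul]; simp, fun τ => ?_⟩
    have h := hnat n (u + ((-n : ℤ) : ℂ)) τ
    have e : u + ((-n : ℤ) : ℂ) + n = u := by push_cast; ring
    rw [e] at h
    rw [h, ← mul_assoc, ← pow_add, ← two_mul, pow_mul]
    simp

/-! ### Half products of division values -/

/-- `∏_{1 ≤ l ≤ (p-1)/2} θ(l/p, τ)/η(τ)³`, up to a constant. -/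
noncomputable def thetaHalfProd (p : ℕ) (τ : ℍ) : ℂ :=
  ∏ l ∈ Finset.Ico 1 (p / 2).succ, thetaQuot (l / p) τ

lemma thetaQuot_div_eq (p : ℕ) (hp : 0 < p) (x : ℤ) : ∃ ε : ℂ, ε ^ 2 = 1 ∧
    ∀ τ : ℍ, thetaQuot (x / p) τ = ε * thetaQuot (((x : ZMod p).valMinAbs.natAbs : ℕ) / p) τ := by
  have : NeZero p := ⟨hp.ne'⟩
  have hp0 : (p : ℂ) ≠ 0 := Nat.cast_ne_zero.2 hp.ne'
  set y := (x : ZMod p).valMinAbs with hy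
  have hdvd : (p : ℤ) ∣ x - y := by
    rw [← ZMod.intCast_eq_intCast_iff_dvd_sub, hy, ZMod.coe_valMinAbs]
  obtain ⟨t, ht⟩ := hdvd
  have hx : (x : ℂ) / p = (y : ℂ) / p + t := by
    have : (x : ℂ) = y + p * t := by
      have : x = y + p * t := by linear_combination ht
      exact_mod_cast this
    rw [this]
    field_simp
  obtain ⟨ε, hε, h⟩ := thetaQuot_add_int ((y : ℂ) / p) t
  rcases Int.natAbs_eq y with hyn | hyn
  · refine ⟨ε, hε, fun τ => ?_⟩
    have : (y : ℂ) = (y.natAbs : ℕ) := by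
      conv_lhs => rw [hyn]
      exact Int.cast_natCast _
    rw [hx, h, this]
  · refine ⟨-ε, by rw [neg_sq, hε], fun τ => ?_⟩
    have : (y : ℂ) = -((y.natAbs : ℕ) : ℂ) := by
      conv_lhs => rw [hyn]
      rw [Int.cast_neg, Int.cast_natCast]
    rw [hx, h, this, neg_div, thetaQuot_neg]
    ring

/-- As in Gauss's lemma, multiplication by a unit `δ` permutes `1, …, (p-1)/2` up to sign modulo
`p`, and `thetaQuot` is odd and antiperiodic under `u ↦ u + 1`. -/
lemma thetaHalfProd_mul (p : ℕ) [hp : Fact p.Prime] (δ : ℤ) (hδ : (δ : ZMod p) ≠ 0) :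
    ∃ ε : ℂ, ε ^ 2 = 1 ∧ ∀ τ : ℍ,
      ∏ l ∈ Finset.Ico 1 (p / 2).succ, thetaQuot ((l : ℂ) / p * δ) τ = ε * thetaHalfProd p τ := by
  choose e he h using fun l : ℕ => thetaQuot_div_eq p hp.1.pos (δ * l)
  refine ⟨∏ l ∈ Finset.Ico 1 (p / 2).succ, e l, ?_, fun τ => ?_⟩
  · rw [← Finset.prod_pow]
    exact Finset.prod_eq_one fun l _ => he l
  · have hG := congrArg (fun s : Multiset ℕ => (s.map fun l : ℕ => thetaQuot ((l : ℂ) / p) τ).prod)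
      (ZMod.Ico_map_valMinAbs_natAbs_eq_Ico_map_id p (δ : ZMod p) hδ)
    simp only [Multiset.map_map] at hG
    have hG' : ∏ l ∈ Finset.Ico 1 (p / 2).succ,
        thetaQuot ((((δ : ZMod p) * (l : ZMod p)).valMinAbs.natAbs : ℕ) / p) τ =
        thetaHalfProd p τ := by
      exact hG
    rw [← hG', ← Finset.prod_mul_distrib]
    refine Finset.prod_congr rfl fun l _ => ?_
    have h1 := h l τ
    have e1 : ((δ * (l : ℤ) : ℤ) : ZMod p) = (δ : ZMod p) * (l : ZMod p) := by push_cast; ring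
    rw [e1] at h1
    rw [← h1]
    congr 1
    push_cast
    ring

/-- The automorphy factor of `thetaHalfProd` on `Γ₀(p)`, up to a sign. -/
noncomputable def halfFactor (p c : ℕ) (δ : ℤ) (l : ℕ) : ℂ :=
  (-1) ^ (l * c) * expTwoPiI (-(((l * c : ℕ) : ℂ) * ((l : ℂ) / p * δ) / 2))

lemma thetaHalfProd_smul (p : ℕ) (hp : 0 < p) (γ : SL(2, ℤ)) (c : ℕ) (hc : γ 1 0 = p * c) (τ : ℍ) :
    UpperHalfPlane.denom γ τ ^ (p / 2) * thetaHalfProd p (γ • τ) =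
      (∏ l ∈ Finset.Ico 1 (p / 2).succ, halfFactor p c (γ 1 1) l) *
        ∏ l ∈ Finset.Ico 1 (p / 2).succ, thetaQuot ((l : ℂ) / p * (γ 1 1 : ℤ)) τ := by
  have hp0 : (p : ℂ) ≠ 0 := Nat.cast_ne_zero.2 hp.ne'
  have hcard : UpperHalfPlane.denom γ τ ^ (p / 2) =
      ∏ l ∈ Finset.Ico 1 (p / 2).succ, UpperHalfPlane.denom γ τ := by simp
  rw [hcard, thetaHalfProd, ← Finset.prod_mul_distrib, ← Finset.prod_mul_distrib]
  refine Finset.prod_congr rfl fun l _ => ?_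
  rw [thetaQuot_smul γ ((l : ℂ) / p) (l * c) (by rw [hc]; push_cast; field_simp)]
  rfl

lemma dvd_prime_sq_sub_one {p : ℕ} (hp : p.Prime) (hp3 : 3 < p) : 24 ∣ p ^ 2 - 1 := by
  have h2 : p % 2 = 1 := hp.eq_two_or_odd.resolve_left (by omega)
  have h3 : p % 3 ≠ 0 := fun h => by
    have := (Nat.prime_dvd_prime_iff_eq Nat.prime_three hp).1 (Nat.dvd_of_mod_eq_zero h)
    omega
  have h8 : p ^ 2 % 8 = 1 := by
    have : p % 8 = 1 ∨ p % 8 = 3 ∨ p % 8 = 5 ∨ p % 8 = 7 := by omega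
    rcases this with h | h | h | h <;> simp [Nat.pow_mod, h]
  have h9 : p ^ 2 % 3 = 1 := by
    have : p % 3 = 1 ∨ p % 3 = 2 := by omega
    rcases this with h | h <;> simp [Nat.pow_mod, h]
  omega

lemma shift_mul {p : ℕ} (hp : p.Prime) (hp3 : 3 < p) : 24 * shift p + 1 = p ^ 2 := by
  have h := Nat.mul_div_cancel' (dvd_prime_sq_sub_one hp hp3)
  have : 1 ≤ p ^ 2 := Nat.one_le_pow _ _ hp.pos
  rw [shift]
  omega

lemma sum_sq_Ico (m : ℕ) : 6 * ∑ l ∈ Finset.Ico 1 (m + 1), l ^ 2 = m * (m + 1) * (2 * m + 1) := by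
  induction m with
  | zero => simp
  | succ m ih => rw [Finset.sum_Ico_succ_top (by omega), mul_add, ih]; ring

lemma sum_sq_half {p : ℕ} (hp : p.Prime) (hp3 : 3 < p) :
    ∑ l ∈ Finset.Ico 1 (p / 2).succ, l ^ 2 = p * shift p := by
  have h2 : p % 2 = 1 := hp.eq_two_or_odd.resolve_left (by omega)
  obtain ⟨m, hm⟩ : ∃ m, p = 2 * m + 1 := ⟨p / 2, by omega⟩
  have hm2 : p / 2 = m := by omega
  have h := sum_sq_Ico m
  have hs := shift_mul hp hp3
  have h6 : 6 * shift p = m * (m + 1) := by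
    rw [hm] at hs ⊢
    nlinarith
  rw [hm2]
  have : 6 * ∑ l ∈ Finset.Ico 1 (m + 1), l ^ 2 = 6 * (p * shift p) := by
    rw [h, ← h6, ← hm]; ring
  exact Nat.eq_of_mul_eq_mul_left (by norm_num) this

/-- With `2m = 1 + p²`, the `l`-th factor is `e(-mδ/p)` raised to `l²`. The squares sum to `p *
s_p`, which clears the denominator. -/
lemma prod_halfFactor {p : ℕ} (hp : p.Prime) (hp3 : 3 < p) (δ : ℤ) :
    (∏ l ∈ Finset.Ico 1 (p / 2).succ, halfFactor p 1 δ l) *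
      (∏ l ∈ Finset.Ico 1 (p / 2).succ, halfFactor p p δ l) ^ p = 1 := by
  have hp0 : (p : ℂ) ≠ 0 := Nat.cast_ne_zero.2 hp.ne_zero
  have h2 : p % 2 = 1 := hp.eq_two_or_odd.resolve_left (by omega)
  obtain ⟨m, hm⟩ : ∃ m, 1 + p ^ 2 = 2 * m := by
    refine ⟨(1 + p ^ 2) / 2, ?_⟩
    have : p ^ 2 % 2 = 1 := by simp [Nat.pow_mod, h2]
    omega
  have hmC : (1 : ℂ) + p ^ 2 = 2 * m := by exact_mod_cast congrArg (Nat.cast (R := ℂ)) hm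
  have hterm : ∀ l : ℕ, halfFactor p 1 δ l * halfFactor p p δ l ^ p =
      expTwoPiI (-(m * δ) / p) ^ (l ^ 2) := by
    intro l
    rw [halfFactor, halfFactor, mul_pow, ← expTwoPiI_nat_mul, ← expTwoPiI_nat_mul, ← pow_mul,
      mul_mul_mul_comm, ← pow_add, ← expTwoPiI_add,
      show l * 1 + l * p * p = 2 * (l * m) by linear_combination l * hm, pow_mul, neg_one_sq,
      one_pow, one_mul]
    congr 1
    push_cast
    field_simp
    linear_combination -((l : ℂ) ^ 2 * δ) * hmC
  rw [← Finset.prod_pow, ← Finset.prod_mul_distrib, Finset.prod_congr rfl fun l _ => hterm l,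
    Finset.prod_pow_eq_pow_sum, sum_sq_half hp hp3, ← expTwoPiI_nat_mul]
  rw [show ((p * shift p : ℕ) : ℂ) * (-(m * δ) / p) = ((-(shift p * m * δ) : ℤ) : ℂ) by
    push_cast; field_simp, expTwoPiI_intCast]

/-! ### Invariance of `η(p²τ)/η(τ)` -/

/-- The point `pτ` of the upper half-plane. -/
noncomputable def scale (p : ℕ) (hp : 0 < p) (τ : ℍ) : ℍ :=
  ⟨p * τ, by
    have : 0 < (p : ℝ) := by exact_mod_cast hp
    simpa using mul_pos this τ.im_pos⟩

lemma coe_scale (p : ℕ) (hp : 0 < p) (τ : ℍ) : (scale p hp τ : ℂ) = p * τ := rfl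

lemma scale_smul (p : ℕ) (hp : 0 < p) (B B' : SL(2, ℤ)) (h00 : B' 0 0 = B 0 0)
    (h01 : B' 0 1 = p * B 0 1) (h10 : B 1 0 = p * B' 1 0) (h11 : B' 1 1 = B 1 1) (τ : ℍ) :
    scale p hp (B • τ) = B' • scale p hp τ ∧
      UpperHalfPlane.denom B' (scale p hp τ) = UpperHalfPlane.denom B τ := by
  have hd : UpperHalfPlane.denom B' (scale p hp τ) = UpperHalfPlane.denom B τ := by
    rw [ModularGroup.denom_apply, ModularGroup.denom_apply, coe_scale, h10, h11]
    push_cast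
    ring
  refine ⟨?_, hd⟩
  apply UpperHalfPlane.ext
  rw [coe_scale, UpperHalfPlane.coe_specialLinearGroup_apply,
    UpperHalfPlane.coe_specialLinearGroup_apply]
  simp only [algebraMap_int_eq, eq_intCast, Complex.ofReal_intCast]
  rw [h00, h01, h11, h10, coe_scale]
  push_cast
  rw [mul_div_assoc']
  congr 1 <;> ring

/-- A product of theta quotients proportional to `η(p²τ)/η(τ)`. -/
noncomputable def etaQuotAux (p : ℕ) (hp : 0 < p) (τ : ℍ) : ℂ :=
  thetaHalfProd p (scale p hp τ) * thetaHalfProd p τ ^ p * ModularForm.discriminant τ ^ shift p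

lemma discriminant_smul (B : SL(2, ℤ)) (τ : ℍ) :
    ModularForm.discriminant (B • τ) = UpperHalfPlane.denom B τ ^ 12 * ModularForm.discriminant τ := by
  have h := congrFun (SlashInvariantForm.slash_action_generators_SL2Z ModularForm.discriminant_S_invariant
    ModularForm.discriminant_T_invariant B) τ
  have hd := UpperHalfPlane.denom_ne_zero B τ
  rw [ModularForm.SL_slash_apply, zpow_neg] at h
  rw [← h]
  field_simp

lemma etaQuotAux_smul {p : ℕ} (hp : p.Prime) (hp3 : 3 < p) (B : SL(2, ℤ)) (h10 : B 1 0 = (p : ℤ) ^ 2)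
    (τ : ℍ) : etaQuotAux p hp.pos (B • τ) = etaQuotAux p hp.pos τ := by
  have : Fact p.Prime := ⟨hp⟩
  have hdet : B 0 0 * B 1 1 - B 0 1 * B 1 0 = 1 := by
    have := Matrix.SpecialLinearGroup.det_coe B
    rwa [Matrix.det_fin_two] at this
  set δ := B 1 1 with hδ
  -- The conjugate of `B` by `diag(p, 1)`. Its lower left entry is `p`, so the half product at `pτ`
  -- has automorphy parameter `c = 1`, against `c = p` at `τ`.
  let B' : SL(2, ℤ) := ⟨!![B 0 0, p * B 0 1; p, δ], by
    rw [Matrix.det_fin_two_of]; rw [h10] at hdet; linear_combination hdet⟩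
  have b00 : B' 0 0 = B 0 0 := rfl
  have b01 : B' 0 1 = p * B 0 1 := rfl
  have b10 : B' 1 0 = p := rfl
  have b11 : B' 1 1 = δ := rfl
  obtain ⟨hs, hd⟩ := scale_smul p hp.pos B B' b00 b01 (by rw [h10, b10]; ring) b11 τ
  have hδ0 : (δ : ZMod p) ≠ 0 := by
    intro h
    have h1 := congrArg (Int.cast (R := ZMod p)) hdet
    rw [h10] at h1
    push_cast at h1
    rw [h] at h1
    simp at h1
  obtain ⟨ε, hε, hε'⟩ := thetaHalfProd_mul p δ hδ0
  have k1 := thetaHalfProd_smul p hp.pos B' 1 (by rw [b10]; simp) (scale p hp.pos τ)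
  have k2 := thetaHalfProd_smul p hp.pos B p (by rw [h10]; ring) τ
  rw [b11, hε', hd] at k1
  rw [← hδ, hε'] at k2
  have k3 := discriminant_smul B τ
  have hM := prod_halfFactor hp hp3 δ
  have hj : UpperHalfPlane.denom B τ ≠ 0 := UpperHalfPlane.denom_ne_zero B τ
  rw [etaQuotAux, etaQuotAux, hs, k3]
  set j := UpperHalfPlane.denom B τ
  set M₁ := ∏ l ∈ Finset.Ico 1 (p / 2).succ, halfFactor p 1 δ l
  set M₂ := ∏ l ∈ Finset.Ico 1 (p / 2).succ, halfFactor p p δ l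
  have h2 : p % 2 = 1 := hp.eq_two_or_odd.resolve_left (by omega)
  have hεp : ε * ε ^ p = 1 := by
    rw [← pow_succ', show p + 1 = 2 * ((p + 1) / 2) by omega, pow_mul, hε, one_pow]
  -- The weights balance: `(p + 1)(p - 1)/2 = 12 s_p`.
  have hexp : j ^ (p / 2) * (j ^ (p / 2)) ^ p = (j ^ 12) ^ shift p := by
    rw [← pow_mul, ← pow_add, ← pow_mul]
    congr 1
    obtain ⟨m, hm⟩ : ∃ m, p = 2 * m + 1 := ⟨p / 2, by omega⟩
    have hm2 : p / 2 = m := by omega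
    have hs := shift_mul hp hp3
    rw [hm2]
    have : p ^ 2 = (2 * m + 1) ^ 2 := by rw [← hm]
    rw [hm] at hs ⊢
    nlinarith
  have k2p := congrArg (· ^ p) k2
  simp only [mul_pow] at k2p
  rw [mul_pow, ← hexp]
  linear_combination (j ^ (p / 2)) ^ p * thetaHalfProd p (B • τ) ^ p *
      ModularForm.discriminant τ ^ shift p * k1 +
    M₁ * (ε * thetaHalfProd p (scale p hp.pos τ)) * ModularForm.discriminant τ ^ shift p * k2p +
    ε * ε ^ p * (thetaHalfProd p (scale p hp.pos τ) * thetaHalfProd p τ ^ p *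
      ModularForm.discriminant τ ^ shift p) * hM +
    (thetaHalfProd p (scale p hp.pos τ) * thetaHalfProd p τ ^ p *
      ModularForm.discriminant τ ^ shift p) * hεp

lemma zeta_eq (p : ℕ) : zeta p = expTwoPiI (1 / p) := by
  rw [zeta, expTwoPiI, mul_one_div]

lemma zeta_isPrimitiveRoot {p : ℕ} (hp : p ≠ 0) : IsPrimitiveRoot (zeta p) p :=
  Complex.isPrimitiveRoot_exp p hp

lemma zeta_ne_zero (p : ℕ) : zeta p ≠ 0 := Complex.exp_ne_zero _

lemma zeta_pow (p l : ℕ) : zeta p ^ l = expTwoPiI (l / p) := by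
  rw [zeta_eq, ← expTwoPiI_nat_mul]; congr 1; ring

lemma prod_one_sub_zeta_pow_mul {p : ℕ} (hp : 0 < p) (x : ℂ) :
    ∏ l ∈ Finset.range p, (1 - zeta p ^ l * x) = 1 - x ^ p := by
  have hζ := zeta_isPrimitiveRoot hp.ne'
  have h := hζ.pow_sub_pow_eq_prod_sub_mul 1 x hp
  rw [one_pow] at h
  rw [h]
  refine Finset.prod_bij (fun l _ => zeta p ^ l) (fun l _ => ?_) (fun i hi j hj hij => ?_)
    (fun y hy => ?_) (fun _ _ => rfl)
  · rw [Polynomial.mem_nthRootsFinset hp, ← pow_mul, mul_comm, pow_mul, hζ.pow_eq_one, one_pow]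
  · exact hζ.pow_inj (Finset.mem_range.1 hi) (Finset.mem_range.1 hj) hij
  · have : NeZero p := ⟨hp.ne'⟩
    obtain ⟨i, hi, rfl⟩ := hζ.eq_pow_of_pow_eq_one ((Polynomial.mem_nthRootsFinset hp 1).1 hy)
    exact ⟨i, Finset.mem_range.2 hi, rfl⟩

lemma prod_qPochInf_zeta {p : ℕ} (hp : 0 < p) {q : ℂ} (hq : ‖q‖ < 1) :
    ∏ l ∈ Finset.range p, qPochInf (zeta p ^ l * q) q = qPochInf (q ^ p) (q ^ p) := by
  simp only [qPochInf]
  rw [← Multipliable.tprod_finsetProd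
    (fun l _ => multipliable_one_sub (summable_norm_mul_pow (zeta p ^ l * q) hq))]
  refine tprod_congr fun i => ?_
  simp only [mul_assoc]
  rw [prod_one_sub_zeta_pow_mul hp, ← pow_succ', ← pow_succ', ← pow_mul, ← pow_mul, mul_comm]

/-- In the product over all `p`-th roots of unity, `l = 0` stands alone and `l` pairs with `p - l`.
-/
lemma prod_qPochInf_half {p : ℕ} (hp : p % 2 = 1) {q : ℂ} (hq : ‖q‖ < 1) :
    qPochInf q q * ∏ l ∈ Finset.Ico 1 (p / 2).succ,
      (qPochInf (expTwoPiI (l / p) * q) q * qPochInf (expTwoPiI (-(l / p)) * q) q) =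
      qPochInf (q ^ p) (q ^ p) := by
  have hp0 : 0 < p := by omega
  have hpC : (p : ℂ) ≠ 0 := Nat.cast_ne_zero.2 hp0.ne'
  have h := prod_qPochInf_zeta hp0 hq
  simp only [zeta_pow] at h
  rw [← h, Finset.prod_mul_distrib, Finset.prod_range_eq_mul_Ico _ hp0]
  congr 1
  · simp [expTwoPiI_zero]
  · rw [← Finset.prod_Ico_consecutive _ (show 1 ≤ (p / 2).succ by omega)
      (show (p / 2).succ ≤ p by omega)]
    congr 1
    have hr := Finset.prod_Ico_reflect (fun l : ℕ => qPochInf (expTwoPiI (l / p) * q) q) 1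
      (show (p / 2).succ ≤ p + 1 by omega)
    rw [show p + 1 - (p / 2).succ = (p / 2).succ by omega, show p + 1 - 1 = p by omega] at hr
    rw [← hr]
    refine Finset.prod_congr rfl fun l hl => ?_
    have hl' := Finset.mem_Ico.1 hl
    have : ((p - l : ℕ) : ℂ) / p = -(l / p) + (1 : ℕ) := by
      rw [Nat.cast_sub (by omega)]; field_simp; push_cast; ring
    rw [this, expTwoPiI_add, expTwoPiI_natCast, mul_one]

/-- `∏_{1 ≤ l ≤ (p-1)/2} 2i sin(πl/p)`. -/
noncomputable def sinHalfProd (p : ℕ) : ℂ :=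
  ∏ l ∈ Finset.Ico 1 (p / 2).succ, (expTwoPiI (l / p / 2) - expTwoPiI (-(l / p) / 2))

lemma expTwoPiI_half_sub (x : ℝ) :
    expTwoPiI (x / 2) - expTwoPiI (-x / 2) = 2 * Complex.I * (Real.sin (x * Real.pi) : ℝ) := by
  rw [expTwoPiI, expTwoPiI, Complex.ofReal_sin, Complex.sin]
  have h1 : 2 * (Real.pi : ℂ) * Complex.I * (x / 2) = ((x * Real.pi : ℝ) : ℂ) * Complex.I := by
    push_cast; ring
  have h2 : 2 * (Real.pi : ℂ) * Complex.I * (-x / 2) = -((x * Real.pi : ℝ) : ℂ) * Complex.I := by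
    push_cast; ring
  rw [h1, h2]
  linear_combination (Complex.exp (((x * Real.pi : ℝ) : ℂ) * Complex.I) -
    Complex.exp (-((x * Real.pi : ℝ) : ℂ) * Complex.I)) * Complex.I_sq

lemma sin_mul_pi_ne_zero {l p : ℕ} (hl : 0 < l) (hlp : l < p) :
    Real.sin ((l / p : ℝ) * Real.pi) ≠ 0 := by
  have hp : (0 : ℝ) < p := by exact_mod_cast hl.trans hlp
  have hl' : (0 : ℝ) < l := by exact_mod_cast hl
  have h1 : (l / p : ℝ) < 1 := (div_lt_one hp).2 (by exact_mod_cast hlp)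
  exact (Real.sin_pos_of_pos_of_lt_pi (by positivity)
    (by nlinarith [Real.pi_pos])).ne'

lemma expTwoPiI_half_sub_nat (l p : ℕ) :
    expTwoPiI (l / p / 2) - expTwoPiI (-(l / p) / 2) =
      2 * Complex.I * (Real.sin ((l / p : ℝ) * Real.pi) : ℝ) := by
  rw [← expTwoPiI_half_sub]
  push_cast
  rfl

lemma expTwoPiI_half_sub_ne_zero {l p : ℕ} (hl : 0 < l) (hlp : l < p) :
    expTwoPiI (l / p / 2) - expTwoPiI (-(l / p) / 2) ≠ 0 := by
  rw [expTwoPiI_half_sub_nat]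
  have := sin_mul_pi_ne_zero hl hlp
  exact mul_ne_zero (mul_ne_zero two_ne_zero Complex.I_ne_zero) (Complex.ofReal_ne_zero.2 this)

lemma sinHalfProd_ne_zero (p : ℕ) : sinHalfProd p ≠ 0 := by
  refine Finset.prod_ne_zero_iff.2 fun l hl => ?_
  have := Finset.mem_Ico.1 hl
  exact expTwoPiI_half_sub_ne_zero (by omega) (by omega)

lemma thetaHalfProd_eq {p : ℕ} (hp : p % 2 = 1) (τ : ℍ) :
    thetaHalfProd p τ = sinHalfProd p * qPochInf (nome τ ^ p) (nome τ ^ p) /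
      qPochInf (nome τ) (nome τ) ^ p := by
  have hq := norm_nome_lt_one τ
  have hne := qPochInf_ne_zero hq hq
  have h := prod_qPochInf_half hp hq
  have hpow : qPochInf (nome τ) (nome τ) ^ p =
      qPochInf (nome τ) (nome τ) * (qPochInf (nome τ) (nome τ) ^ 2) ^ (p / 2) := by
    rw [← pow_mul, ← pow_succ']; congr 1; omega
  simp only [thetaHalfProd, thetaQuot]
  rw [Finset.prod_div_distrib, Finset.prod_mul_distrib, ← sinHalfProd, Finset.prod_const,
    Nat.card_Ico, show (p / 2).succ - 1 = p / 2 by omega, ← h, hpow]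
  generalize ∏ l ∈ Finset.Ico 1 (p / 2).succ,
      (qPochInf (expTwoPiI (l / p) * nome τ) (nome τ) *
        qPochInf (expTwoPiI (-(l / p)) * nome τ) (nome τ)) = P
  field_simp

lemma discriminant_eq_nome (τ : ℍ) :
    ModularForm.discriminant τ = nome τ * qPochInf (nome τ) (nome τ) ^ 24 := by
  have hq := norm_nome_lt_one τ
  have hn : Function.Periodic.qParam 1 (τ : ℂ) = nome τ := by
    simp [Function.Periodic.qParam, nome]
  have hm := (multipliable_one_sub (summable_norm_mul_pow (nome τ) hq)).tprod_pow 24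
  have ht : ∏' n, (1 - ModularForm.eta_q n τ) ^ 24 = ∏' n, (1 - nome τ * nome τ ^ n) ^ 24 :=
    tprod_congr fun n => by rw [ModularForm.eta_q, hn, pow_succ' (nome τ) n]
  rw [ModularForm.discriminant_eq_q_prod, hn, ht, hm]
  rfl

lemma nome_scale (p : ℕ) (hp : 0 < p) (τ : ℍ) : nome (scale p hp τ) = nome τ ^ p := by
  rw [nome_eq, nome_eq, coe_scale, expTwoPiI_nat_mul]

/-- The quotient `η(p²τ)/η(τ)`. -/
noncomputable def etaQuot (p : ℕ) (τ : ℍ) : ℂ :=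
  nome τ ^ shift p * qPochInf (nome τ ^ p ^ 2) (nome τ ^ p ^ 2) / qPochInf (nome τ) (nome τ)

/-- The factors `(q^p; q^p)_∞` cancel, and since `p² - 24 s_p = 1` a single `(q; q)_∞` is left in
the denominator. -/
lemma etaQuotAux_eq {p : ℕ} (hp : p.Prime) (hp3 : 3 < p) (τ : ℍ) :
    etaQuotAux p hp.pos τ = sinHalfProd p ^ (p + 1) * etaQuot p τ := by
  have h2 : p % 2 = 1 := hp.eq_two_or_odd.resolve_left (by omega)
  have hq := norm_nome_lt_one τ
  have hne := qPochInf_ne_zero hq hq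
  have hqp : ‖nome τ ^ p‖ < 1 := by
    rw [norm_pow]; exact pow_lt_one₀ (norm_nonneg _) hq hp.ne_zero
  have hnep := qPochInf_ne_zero hqp hqp
  have hs := shift_mul hp hp3
  rw [etaQuotAux, etaQuot, thetaHalfProd_eq h2, thetaHalfProd_eq h2, discriminant_eq_nome, nome_scale,
    ← pow_mul, ← pow_two, mul_pow, ← pow_mul, div_pow, mul_pow, ← pow_mul, ← pow_two, ← hs]
  field_simp
  ring

/-- `η(p²τ)/η(τ)` is invariant under `Γ₀(p²)`. -/
theorem etaQuot_smul {p : ℕ} (hp : p.Prime) (hp3 : 3 < p) (B : SL(2, ℤ))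
    (h10 : B 1 0 = (p : ℤ) ^ 2) (τ : ℍ) : etaQuot p (B • τ) = etaQuot p τ := by
  have h := etaQuotAux_smul hp hp3 B h10 τ
  rw [etaQuotAux_eq hp hp3, etaQuotAux_eq hp hp3] at h
  exact mul_left_cancel₀ (pow_ne_zero _ (sinHalfProd_ne_zero p)) h

lemma thetaQuot_div_ne_zero {l p : ℕ} (hl : 0 < l) (hlp : l < p) (τ : ℍ) :
    thetaQuot (l / p) τ ≠ 0 := by
  have hq := norm_nome_lt_one τ
  have hn : ‖expTwoPiI (l / p)‖ = 1 := by
    rw [← zeta_pow, norm_pow, norm_eq_one_of_pow (hl.trans hlp)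
      (zeta_isPrimitiveRoot (hl.trans hlp).ne').pow_eq_one, one_pow]
  have h1 : ‖expTwoPiI (l / p) * nome τ‖ < 1 := by rwa [norm_mul, hn, one_mul]
  have h2 : ‖expTwoPiI (-(l / p)) * nome τ‖ < 1 := by
    rwa [expTwoPiI_neg, norm_mul, norm_inv, hn, inv_one, one_mul]
  exact div_ne_zero (mul_ne_zero (expTwoPiI_half_sub_ne_zero hl hlp)
    (mul_ne_zero (qPochInf_ne_zero h1 hq) (qPochInf_ne_zero h2 hq)))
    (pow_ne_zero _ (qPochInf_ne_zero hq hq))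

/-! ### The dissection and its Fourier inversion -/

/-- The point `(z + t)/p` of the upper half-plane. -/
noncomputable def divPoint (p : ℕ) (hp : 0 < p) (t : ℤ) (z : ℍ) : ℍ :=
  ⟨(z + t) / p, by
    have hp' : 0 < (p : ℝ) := by exact_mod_cast hp
    have : ((z + t : ℂ) / p).im = z.im / p := by
      rw [Complex.div_natCast_im]; simp
    rw [this]
    exact div_pos z.im_pos hp'⟩

lemma coe_divPoint (p : ℕ) (hp : 0 < p) (t : ℤ) (z : ℍ) : (divPoint p hp t z : ℂ) = (z + t) / p := rfl

lemma nome_divPoint_pow (p : ℕ) (hp : 0 < p) (z : ℍ) : nome (divPoint p hp 0 z) ^ p = nome z := by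
  have hpC : (p : ℂ) ≠ 0 := Nat.cast_ne_zero.2 hp.ne'
  rw [nome_eq, nome_eq, ← expTwoPiI_nat_mul, coe_divPoint]
  congr 1
  push_cast
  field_simp
  ring

/-- The crank generating series in `x`, shifted by `x ^ shift p`. -/
noncomputable def shiftedTerm (p : ℕ) (ω x : ℂ) (N : ℕ) : ℂ :=
  if shift p ≤ N then crankCoeff p ω (N - shift p) * x ^ N else 0

lemma summable_shiftedTerm {p : ℕ} (hp : 0 < p) {ω : ℂ} (hω : ω ^ p = 1) {x : ℂ} (hx : ‖x‖ < 1) :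
    Summable (shiftedTerm p ω x) := by
  rw [← summable_nat_add_iff (shift p)]
  refine ((summable_crankCoeff hp hω hx).mul_left (x ^ shift p)).congr fun N => ?_
  rw [shiftedTerm, if_pos (Nat.le_add_left _ _), Nat.add_sub_cancel]
  ring

lemma tsum_shiftedTerm {p : ℕ} (hp : 0 < p) {ω : ℂ} (hω : ω ^ p = 1) {x : ℂ} (hx : ‖x‖ < 1) :
    ∑' N, shiftedTerm p ω x N =
      x ^ shift p * (qPochInf x x / (qPochInf (ω * x) x * qPochInf (x / ω) x)) := by
  rw [← (summable_shiftedTerm hp hω hx).sum_add_tsum_nat_add (shift p),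
    Finset.sum_eq_zero, zero_add, ← tsum_crankCoeff hp hω hx, ← tsum_mul_left]
  · refine tsum_congr fun N => ?_
    rw [shiftedTerm, if_pos (Nat.le_add_left _ _), Nat.add_sub_cancel]
    ring
  · intro N hN
    rw [shiftedTerm, if_neg (by simpa using hN)]

lemma shiftedTerm_eq (p m : ℕ) (ω x : ℂ) (z : ℍ) (hx : x ^ p = nome z) (n : ℕ) :
    shiftedTerm p ω x (m + p * n) = x ^ m * seriesTerm p m ω z n := by
  rw [shiftedTerm, seriesTerm, add_comm m, ← hx]
  split_ifs with h
  · rw [crankCoeff, pow_add, pow_mul]; ring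
  · rw [mul_zero]

theorem summable_seriesTerm {p : ℕ} (hp : 0 < p) (m : ℕ) {ω : ℂ} (hω : ω ^ p = 1) (z : ℍ) :
    Summable (seriesTerm p m ω z) := by
  have hx := nome_divPoint_pow p hp z
  set x := nome (divPoint p hp 0 z)
  have hx0 : x ≠ 0 := nome_ne_zero _
  have hinj : Function.Injective fun n : ℕ => m + p * n := fun a b h =>
    Nat.eq_of_mul_eq_mul_left hp (add_left_cancel h)
  have h := ((summable_shiftedTerm hp hω (norm_nome_lt_one (divPoint p hp 0 z))).comp_injective
    hinj).mul_left (x ^ m)⁻¹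
  refine h.congr fun n => ?_
  rw [Function.comp, shiftedTerm_eq p m ω x z hx, inv_mul_cancel_left₀ (pow_ne_zero _ hx0)]

/-- With `x = e(z/p)`, the term `N = m + p n` of the shifted series belongs to `K p m`: the
prefactor `q^(m/p)` is `x ^ m`, and `q^p = x^(p²)` accounts for the infinite product. -/
lemma sum_K_eq {p : ℕ} (hp : 0 < p) {ω : ℂ} (hω : ω ^ p = 1) (z : ℍ) :
    ∑ m ∈ Finset.range p, K p m ω z = qPochInf (nome (divPoint p hp 0 z) ^ p ^ 2)
        (nome (divPoint p hp 0 z) ^ p ^ 2) *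
      ∑' N, shiftedTerm p ω (nome (divPoint p hp 0 z)) N := by
  have : NeZero p := ⟨hp.ne'⟩
  have hx := nome_divPoint_pow p hp z
  have hs := summable_shiftedTerm hp hω (norm_nome_lt_one (divPoint p hp 0 z))
  rw [Nat.sumByResidueClasses hs p, Finset.mul_sum]
  refine Finset.sum_nbij' (fun m => (m : ZMod p)) (fun j => j.val) (fun _ _ => Finset.mem_univ _)
    (fun j _ => Finset.mem_range.2 (ZMod.val_lt j))
    (fun m hm => ZMod.val_cast_of_lt (Finset.mem_range.1 hm))
    (fun j _ => ZMod.natCast_zmod_val j) (fun m hm => ?_)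
  rw [ZMod.val_cast_of_lt (Finset.mem_range.1 hm)]
  simp only [shiftedTerm_eq p m ω _ z hx]
  rw [tsum_mul_left, K]
  have e1 : Complex.exp (2 * (Real.pi : ℂ) * Complex.I * (m : ℂ) * (z : ℂ) / (p : ℂ)) =
      nome (divPoint p hp 0 z) ^ m := by
    rw [nome_eq, ← expTwoPiI_nat_mul, expTwoPiI, coe_divPoint]
    congr 1
    push_cast
    ring
  have e2 : ∏' n : ℕ, (1 - nome z ^ (p * (n + 1))) = qPochInf (nome (divPoint p hp 0 z) ^ p ^ 2)
      (nome (divPoint p hp 0 z) ^ p ^ 2) := by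
    rw [qPochInf]
    refine tprod_congr fun n => ?_
    rw [← hx, ← pow_succ', ← pow_mul, ← pow_mul]
    congr 2
    ring
  rw [e1, e2]
  ring

lemma sum_K_eq_thetaQuot {p l : ℕ} (hl : 0 < l) (hlp : l < p) (z : ℍ) :
    (∑ m ∈ Finset.range p, K p m (zeta p ^ l) z) *
        thetaQuot (l / p) (divPoint p (hl.trans hlp) 0 z) =
      (expTwoPiI (l / p / 2) - expTwoPiI (-(l / p) / 2)) *
        etaQuot p (divPoint p (hl.trans hlp) 0 z) := by
  have hp := hl.trans hlp
  have hω : (zeta p ^ l) ^ p = 1 := by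
    rw [← pow_mul, mul_comm, pow_mul, (zeta_isPrimitiveRoot hp.ne').pow_eq_one, one_pow]
  have hn := norm_eq_one_of_pow hp hω
  rw [sum_K_eq hp hω]
  generalize divPoint p hp 0 z = τ
  have hq := norm_nome_lt_one τ
  rw [tsum_shiftedTerm hp hω hq, thetaQuot, etaQuot]
  have h1 : ‖zeta p ^ l * nome τ‖ < 1 := by rwa [norm_mul, hn, one_mul]
  have h2 : ‖nome τ / zeta p ^ l‖ < 1 := by rwa [norm_div, hn, div_one]
  have e : expTwoPiI (-(l / p)) * nome τ = nome τ / zeta p ^ l := by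
    rw [expTwoPiI_neg, zeta_pow]; ring
  rw [e, ← zeta_pow]
  have n1 := qPochInf_ne_zero h1 hq
  have n2 := qPochInf_ne_zero h2 hq
  have n3 := qPochInf_ne_zero hq hq
  field_simp

/-- Only the fractional power `q^(m/p)` notices an integral translation, so the `K p m` are
eigenfunctions with distinct characters; this is what separates them. -/
lemma K_vadd {p : ℕ} (m : ℕ) (ω : ℂ) (t : ℤ) (z : ℍ) :
    K p m ω ((t : ℝ) +ᵥ z) = zeta p ^ ((m : ℤ) * t) * K p m ω z := by
  have hn : nome ((t : ℝ) +ᵥ z) = nome z := by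
    rw [nome_eq, nome_eq, UpperHalfPlane.coe_vadd, expTwoPiI_add, Complex.ofReal_intCast,
      expTwoPiI_intCast, one_mul]
  have hs : seriesTerm p m ω ((t : ℝ) +ᵥ z) = seriesTerm p m ω z := by
    funext n
    rw [seriesTerm, seriesTerm, hn]
  rw [K, K, hn, hs, zeta_eq, ← expTwoPiI_int_mul, expTwoPiI, UpperHalfPlane.coe_vadd, ← mul_assoc,
    ← mul_assoc, ← Complex.exp_add]
  congr 3
  push_cast
  ring

lemma divPoint_vadd (p : ℕ) (hp : 0 < p) (t : ℤ) (z : ℍ) :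
    divPoint p hp 0 ((t : ℝ) +ᵥ z) = divPoint p hp t z := by
  apply UpperHalfPlane.ext
  rw [coe_divPoint, coe_divPoint, UpperHalfPlane.coe_vadd]
  push_cast
  ring

lemma sum_zeta_zpow {p : ℕ} (hp : 0 < p) (c : ℤ) :
    ∑ j ∈ Finset.range p, zeta p ^ (c * j) = if (p : ℤ) ∣ c then (p : ℂ) else 0 := by
  have hζ := zeta_isPrimitiveRoot hp.ne'
  have e : ∀ j : ℕ, zeta p ^ (c * j) = (zeta p ^ c) ^ j := fun j => by
    rw [zpow_mul, zpow_natCast]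
  simp only [e]
  split_ifs with h
  · rw [(hζ.zpow_eq_one_iff_dvd c).2 h]; simp
  · have hne : zeta p ^ c ≠ 1 := fun h1 => h ((hζ.zpow_eq_one_iff_dvd c).1 h1)
    have h1 := mul_neg_geom_sum (zeta p ^ c) p
    have h2 : (zeta p ^ c) ^ p = 1 := by
      rw [← zpow_natCast, ← zpow_mul, mul_comm, zpow_mul, zpow_natCast, hζ.pow_eq_one, one_zpow]
    rw [h2, sub_self] at h1
    exact (mul_eq_zero.1 h1).resolve_left (sub_ne_zero.2 hne.symm)

/-- Fourier inversion over a complete residue system `b j + t`. -/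
lemma sum_zeta_mul_sum {p : ℕ} (hp : 0 < p) (F : ℕ → ℂ) {m₀ : ℕ} (hm₀ : m₀ < p) (b c t : ℤ)
    (hb : ∀ m < p, (p : ℤ) ∣ m * b - c ↔ m = m₀) :
    ∑ j ∈ Finset.range p, zeta p ^ (-(c * j)) * ∑ m ∈ Finset.range p,
      zeta p ^ ((m : ℤ) * (b * j + t)) * F m = p * (zeta p ^ ((m₀ : ℤ) * t) * F m₀) := by
  have hζ := zeta_ne_zero p
  simp only [Finset.mul_sum]
  rw [Finset.sum_comm]
  have h : ∀ m ∈ Finset.range p, ∑ j ∈ Finset.range p,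
      zeta p ^ (-(c * (j : ℤ))) * (zeta p ^ ((m : ℤ) * (b * j + t)) * F m) =
      if m = m₀ then p * (zeta p ^ ((m : ℤ) * t) * F m) else 0 := by
    intro m hm
    have e : ∀ j : ℕ, zeta p ^ (-(c * (j : ℤ))) * (zeta p ^ ((m : ℤ) * (b * j + t)) * F m) =
        zeta p ^ ((m * b - c) * (j : ℤ)) * (zeta p ^ ((m : ℤ) * t) * F m) := by
      intro j
      rw [← mul_assoc, ← mul_assoc, ← zpow_add₀ hζ, ← zpow_add₀ hζ]
      congr 2
      ring
    simp only [e]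
    rw [← Finset.sum_mul, sum_zeta_zpow hp]
    simp only [hb m (Finset.mem_range.1 hm)]
    split_ifs <;> simp
  rw [Finset.sum_congr rfl h, Finset.sum_ite_eq', if_pos (Finset.mem_range.2 hm₀)]

lemma thetaQuot_sub_natCast (u : ℂ) (n : ℕ) (τ : ℍ) :
    thetaQuot (u - n) τ = (-1) ^ n * thetaQuot u τ := by
  induction n with
  | zero => simp
  | succ n ih =>
    have h := thetaQuot_add_one (u - (n + 1 : ℕ)) τ
    rw [show u - ((n + 1 : ℕ) : ℂ) + 1 = u - n by push_cast; ring, ih] at h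
    rw [pow_succ]
    linear_combination h

/-- The transformation of the division value `1/p` under `Γ₀(p²)`. -/
lemma thetaQuot_inv_smul {p : ℕ} (hp : p % 2 = 1) (B : SL(2, ℤ)) (h10 : B 1 0 = (p : ℤ) ^ 2) (d j : ℕ)
    (h11 : B 1 1 = (d : ℤ) - p * j) (τ : ℍ) :
    UpperHalfPlane.denom B τ * thetaQuot ((1 : ℕ) / p) (B • τ) =
      (-1) ^ (d + 1) * thetaQuot (d / p) τ := by
  have hpC : (p : ℂ) ≠ 0 := Nat.cast_ne_zero.2 (by omega)
  have h := thetaQuot_smul B ((1 : ℕ) / p) p (by rw [h10]; push_cast; field_simp) τ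
  have hodd : (-1 : ℂ) ^ p = -1 := Odd.neg_one_pow (Nat.odd_iff.2 hp)
  have e1 : ((1 : ℕ) : ℂ) / p * (B 1 1 : ℤ) = d / p - j := by
    rw [h11]; push_cast; field_simp
  have e2 : expTwoPiI (-(p * ((d : ℂ) / p - j) / 2)) = (-1) ^ d * (-1) ^ j := by
    rw [show -(p * ((d : ℂ) / p - j) / 2) = (d : ℂ) * (-(1 / 2)) + ((p * j : ℕ) : ℂ) * (1 / 2) by
      push_cast; field_simp; ring, expTwoPiI_add, expTwoPiI_nat_mul, expTwoPiI_nat_mul,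
      expTwoPiI_neg, expTwoPiI_half, pow_mul, hodd]
    norm_num
  rw [h, e1, e2, thetaQuot_sub_natCast, hodd]
  -- The sign `(-1)^j` from the root of unity meets the one from shifting the division value by `j`,
  -- so the result does not depend on `j`. The extra `+ 1` in the exponent comes from `(-1)^p = -1`.
  have hj : ((-1 : ℂ) ^ j) * (-1) ^ j = 1 := by rw [← mul_pow]; simp
  rw [pow_succ]
  linear_combination (-1) * (-1 : ℂ) ^ d * thetaQuot (d / p) τ * hj

/-- The transformation of the full generating series under the lifted matrix. -/
lemma sum_K_smul {p : ℕ} (hp : p.Prime) (hp3 : 3 < p) {a d : ℕ} (hd : 0 < d) (hdp : d < p) {k : ℤ}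
    (A : SL(2, ℤ)) (hA : (A : Matrix (Fin 2) (Fin 2) ℤ) = !![(a : ℤ), k; (p : ℤ), (d : ℤ)])
    (j : ℕ) (z : ℍ) :
    ∑ m ∈ Finset.range p, K p m (zeta p) ((((a : ℤ) ^ 2 * j - a * k : ℤ) : ℝ) +ᵥ (A • z)) =
      ((Real.sin (Real.pi / p) / Real.sin (d * Real.pi / p) : ℝ) : ℂ) * (-1) ^ (d + 1) *
        UpperHalfPlane.denom A z *
        ∑ m ∈ Finset.range p, K p m (zeta p ^ d) (((j : ℤ) : ℝ) +ᵥ z) := by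
  have h2 : p % 2 = 1 := hp.eq_two_or_odd.resolve_left (by omega)
  have hpC : (p : ℂ) ≠ 0 := Nat.cast_ne_zero.2 hp.ne_zero
  have a00 : A 0 0 = a := congrFun (congrFun hA 0) 0
  have a01 : A 0 1 = k := congrFun (congrFun hA 0) 1
  have a10 : A 1 0 = p := congrFun (congrFun hA 1) 0
  have a11 : A 1 1 = d := congrFun (congrFun hA 1) 1
  have hdet : (a : ℤ) * d - k * p = 1 := by
    have := Matrix.SpecialLinearGroup.det_coe A
    rwa [Matrix.det_fin_two, a00, a01, a10, a11] at this
  -- The matrix product `(1 t; 0 p) A (1 j; 0 p)⁻¹` is integral exactly when `t d ≡ a j - k` modulo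
  -- `p`. As `a d ≡ 1`, this `t` qualifies, and `B` is the resulting matrix.
  set t : ℤ := (a : ℤ) ^ 2 * j - a * k with ht
  let B : SL(2, ℤ) := ⟨!![a + t * p, k * a * j - k ^ 2 - t * j; (p : ℤ) ^ 2, (d : ℤ) - p * j], by
    rw [Matrix.det_fin_two_of, ht]
    linear_combination (1 + p * (a * j - k)) * hdet⟩
  have b00 : B 0 0 = a + t * p := rfl
  have b01 : B 0 1 = k * a * j - k ^ 2 - t * j := rfl
  have b10 : B 1 0 = (p : ℤ) ^ 2 := rfl
  have b11 : B 1 1 = (d : ℤ) - p * j := rfl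
  set τ := divPoint p hp.pos (j : ℤ) z with hτ
  have hden : UpperHalfPlane.denom B τ = UpperHalfPlane.denom A z := by
    rw [ModularGroup.denom_apply, ModularGroup.denom_apply, b10, b11, a10, a11, hτ, coe_divPoint]
    push_cast
    field_simp
    ring
  have hA0 : UpperHalfPlane.denom A z ≠ 0 := UpperHalfPlane.denom_ne_zero A z
  have hpt : divPoint p hp.pos t (A • z) = B • τ := by
    apply UpperHalfPlane.ext
    have hA0' := hA0
    rw [ModularGroup.denom_apply, a10, a11] at hA0'
    rw [coe_divPoint, UpperHalfPlane.coe_specialLinearGroup_apply,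
      UpperHalfPlane.coe_specialLinearGroup_apply]
    simp only [algebraMap_int_eq, eq_intCast, Complex.ofReal_intCast]
    have e : ((B 1 0 : ℤ) : ℂ) * τ + (B 1 1 : ℤ) = (p : ℤ) * z + (d : ℤ) := by
      rw [b10, b11, hτ, coe_divPoint]
      push_cast
      field_simp
      ring
    rw [e, b00, b01, a00, a01, a10, a11, hτ, coe_divPoint]
    have hdetC : (a : ℂ) * d - k * p = 1 := by exact_mod_cast congrArg (Int.cast (R := ℂ)) hdet
    have htC : (t : ℂ) = a ^ 2 * j - a * k := by rw [ht]; push_cast; ring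
    rw [htC]
    push_cast at hA0' ⊢
    field_simp
    have hD : (z : ℂ) * p + d ≠ 0 := by rwa [mul_comm]
    rw [div_add' _ _ _ hD, div_left_inj' hD]
    linear_combination ((a : ℂ) * j - k) * hdetC - p * z * htC
  have hB := thetaQuot_inv_smul h2 B b10 d j b11 τ
  have hf := etaQuot_smul hp hp3 B b10 τ
  have s1 := sum_K_eq_thetaQuot one_pos (show 1 < p by omega) ((t : ℝ) +ᵥ (A • z))
  have s2 := sum_K_eq_thetaQuot hd hdp (((j : ℤ) : ℝ) +ᵥ z)
  rw [divPoint_vadd, hpt, hf, pow_one] at s1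
  rw [divPoint_vadd, ← hτ] at s2
  rw [hden] at hB
  have hθ := thetaQuot_div_ne_zero hd hdp τ
  have hθ1 := thetaQuot_div_ne_zero one_pos (show 1 < p by omega) (B • τ)
  have hσ := sin_mul_pi_ne_zero hd hdp
  rw [expTwoPiI_half_sub_nat] at s1 s2
  have r1 : Real.sin (((1 : ℕ) : ℝ) / p * Real.pi) = Real.sin (Real.pi / p) := by
    congr 1; push_cast; ring
  have r2 : Real.sin ((d : ℝ) / p * Real.pi) = Real.sin (d * Real.pi / p) := by
    congr 1; ring
  rw [r1] at s1
  rw [r2] at s2 hσ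
  have hσC : ((Real.sin (d * Real.pi / p) : ℝ) : ℂ) ≠ 0 := Complex.ofReal_ne_zero.2 hσ
  rw [Complex.ofReal_div]
  generalize ((Real.sin (d * Real.pi / p) : ℝ) : ℂ) = σd at *
  generalize ((Real.sin (Real.pi / p) : ℝ) : ℂ) = σ1 at *
  have hs : ((-1 : ℂ) ^ (d + 1)) * (-1) ^ (d + 1) = 1 := by rw [← mul_pow]; simp
  generalize (-1 : ℂ) ^ (d + 1) = s at *
  generalize ∑ m ∈ Finset.range p, K p m (zeta p) ((t : ℝ) +ᵥ (A • z)) = H1 at *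
  generalize ∑ m ∈ Finset.range p, K p m (zeta p ^ d) (((j : ℤ) : ℝ) +ᵥ z) = Hd at *
  generalize UpperHalfPlane.denom A z = D at *
  generalize thetaQuot (((1 : ℕ) : ℂ) / p) (B • τ) = θ1 at *
  generalize thetaQuot ((d : ℂ) / p) τ = θd at *
  apply mul_right_cancel₀ (mul_ne_zero hθ1 hσC)
  have e := div_mul_cancel₀ σ1 hσC
  linear_combination σd * s1 - σ1 * s * Hd * hB - σ1 * s2 - σ1 * Hd * θd * hs - s * D * Hd * θ1 * e

lemma dvd_mul_sq_sub_iff {p : ℕ} (hp : p.Prime) {a : ℕ} (ha : 1 ≤ a ∧ a ≤ p - 1) (m : ℕ) {n : ℕ}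
    (hn : n < p) : (p : ℤ) ∣ n * (a : ℤ) ^ 2 - m * (a : ℤ) ^ 2 ↔ n = m % p := by
  have hpa : IsCoprime (p : ℤ) ((a : ℤ) ^ 2) := by
    refine IsCoprime.pow_right ?_
    rw [Nat.isCoprime_iff_coprime]
    exact (Nat.Prime.coprime_iff_not_dvd hp).2 fun h => by
      have := Nat.le_of_dvd (by omega) h
      omega
  rw [← sub_mul, show (p : ℤ) ∣ (n - m : ℤ) * (a : ℤ) ^ 2 ↔ (p : ℤ) ∣ (n : ℤ) - m from
    ⟨hpa.dvd_of_dvd_mul_right, fun h => h.mul_right _⟩]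
  rw [← Int.modEq_iff_dvd, Int.natCast_modEq_iff, Nat.ModEq, Nat.mod_eq_of_lt hn, eq_comm]

/-- The identities `sum_K_smul` for `j < p` are weighted by `ζ_p ^ (-m a² j)` and summed. On the
left the character of index `n` is `ζ_p ^ (n a² j)`, which selects `n = m`; on the right it is `ζ_p
^ (n j)`, which selects `n ≡ m a²`. The factor `ζ_p ^ (m a k)` compensates the constant part `-a k`
of the translation. -/
theorem K_slash {p : ℕ} (hp : p.Prime) (hp3 : 3 < p) {a d : ℕ} (ha : 1 ≤ a ∧ a ≤ p - 1)
    (hd : 1 ≤ d ∧ d ≤ p - 1) {k : ℤ} (A : SL(2, ℤ))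
    (hA : (A : Matrix (Fin 2) (Fin 2) ℤ) = !![(a : ℤ), k; (p : ℤ), (d : ℤ)]) {m : ℕ} (hm : m < p) :
    K p m (zeta p) ∣[(1 : ℤ)] A =
      (((Real.sin (Real.pi / p) / Real.sin (d * Real.pi / p) : ℝ) : ℂ) * (-1) ^ (d + 1) *
          zeta p ^ ((m : ℤ) * (a : ℤ) * k)) • K p (m * a ^ 2 % p) (zeta p ^ d) := by
  ext z
  have hpC : (p : ℂ) ≠ 0 := Nat.cast_ne_zero.2 hp.ne_zero
  have hζ := zeta_ne_zero p
  have hA0 : UpperHalfPlane.denom A z ≠ 0 := UpperHalfPlane.denom_ne_zero A z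
  rw [ModularForm.SL_slash_apply, Pi.smul_apply, smul_eq_mul]
  set S : ℂ := ((Real.sin (Real.pi / p) / Real.sin (d * Real.pi / p) : ℝ) : ℂ) * (-1) ^ (d + 1)
  have f1 := sum_zeta_mul_sum hp.pos (fun n => K p n (zeta p) (A • z)) hm ((a : ℤ) ^ 2)
    ((m : ℤ) * (a : ℤ) ^ 2) (-(a * k)) fun n hn => by
      rw [dvd_mul_sq_sub_iff hp ha m hn, Nat.mod_eq_of_lt hm]
  have f2 := sum_zeta_mul_sum hp.pos (fun n => K p n (zeta p ^ d) z)
    (Nat.mod_lt (m * a ^ 2) hp.pos) 1 ((m : ℤ) * (a : ℤ) ^ 2) 0 fun n hn => by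
      rw [mul_one, ← Int.natCast_pow, ← Nat.cast_mul, ← Int.modEq_iff_dvd, Int.natCast_modEq_iff,
        Nat.ModEq, Nat.mod_eq_of_lt hn, eq_comm]
  have hj : ∀ j : ℕ, ∑ n ∈ Finset.range p, zeta p ^ ((n : ℤ) * ((a : ℤ) ^ 2 * j + -(a * k))) *
      K p n (zeta p) (A • z) = S * UpperHalfPlane.denom A z *
      ∑ n ∈ Finset.range p, zeta p ^ ((n : ℤ) * (1 * j + 0)) * K p n (zeta p ^ d) z := by
    intro j
    have h := sum_K_smul hp hp3 hd.1 (by omega) A hA j z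
    simp only [K_vadd] at h
    simpa only [one_mul, add_zero, ← sub_eq_add_neg] using h
  simp only [hj] at f1
  have f3 : ∀ j : ℕ, zeta p ^ (-((m : ℤ) * (a : ℤ) ^ 2 * j)) * (S * UpperHalfPlane.denom A z *
      ∑ n ∈ Finset.range p, zeta p ^ ((n : ℤ) * (1 * j + 0)) * K p n (zeta p ^ d) z) =
      S * UpperHalfPlane.denom A z * (zeta p ^ (-((m : ℤ) * (a : ℤ) ^ 2 * j)) *
      ∑ n ∈ Finset.range p, zeta p ^ ((n : ℤ) * (1 * j + 0)) * K p n (zeta p ^ d) z) := fun j => by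
    ring
  simp only [f3] at f1
  rw [← Finset.mul_sum, f2, mul_zero, zpow_zero, one_mul] at f1
  have hz : zeta p ^ ((m : ℤ) * (a : ℤ) * k) * zeta p ^ ((m : ℤ) * -(a * k)) = 1 := by
    rw [← zpow_add₀ hζ, show (m : ℤ) * (a : ℤ) * k + (m : ℤ) * -(a * k) = 0 by ring, zpow_zero]
  rw [zpow_neg_one]
  apply mul_right_cancel₀ (mul_ne_zero hpC hA0)
  have hD := inv_mul_cancel₀ hA0
  linear_combination (-(zeta p ^ ((m : ℤ) * (a : ℤ) * k))) * f1 - p * K p m (zeta p) (A • z) * hz +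
    p * K p m (zeta p) (A • z) * hD

lemma bijOn_mul_sq_mod {p : ℕ} (hp : p.Prime) {a : ℕ} (ha : 1 ≤ a ∧ a ≤ p - 1) :
    Set.BijOn (fun m : ℕ => m * a ^ 2 % p) (Set.Iio p) (Set.Iio p) := by
  have hmaps : Set.MapsTo (fun m : ℕ => m * a ^ 2 % p) (Set.Iio p) (Set.Iio p) :=
    fun m _ => Nat.mod_lt _ hp.pos
  have hinj : Set.InjOn (fun m : ℕ => m * a ^ 2 % p) (Set.Iio p) := by
    intro m hm n hn h
    have h1 : ((m * a ^ 2 : ℕ) : ℤ) ≡ ((n * a ^ 2 : ℕ) : ℤ) [ZMOD p] :=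
      (Int.natCast_modEq_iff).2 h
    have h2 := h1.symm.dvd
    push_cast at h2
    rw [dvd_mul_sq_sub_iff hp ha n hm, Nat.mod_eq_of_lt hn] at h2
    exact h2
  exact ((Set.finite_Iio p).injOn_iff_bijOn_of_mapsTo hmaps).1 hinj

end CrankDissection

theorem theorem3p1 (p : ℕ) (hp : p.Prime) (hp3 : 3 < p)
    (a d : ℕ) (ha : 1 ≤ a ∧ a ≤ p - 1) (hd : 1 ≤ d ∧ d ≤ p - 1) (k : ℤ)
    (A : SL(2, ℤ)) (hA0 : A ∈ CongruenceSubgroup.Gamma0 p)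
    (hA : (A : Matrix (Fin 2) (Fin 2) ℤ) = !![(a : ℤ), k; (p : ℤ), (d : ℤ)]) :
    (∀ m < p, ∀ l : ℕ, 1 ≤ l → l ≤ p - 1 → ∀ z : ℍ,
      Summable (CrankDissection.seriesTerm p m (CrankDissection.zeta p ^ l) z)) ∧
    (∀ m < p,
      CrankDissection.K p m (CrankDissection.zeta p) ∣[(1 : ℤ)] A =
        (((Real.sin (Real.pi / p) / Real.sin (d * Real.pi / p) : ℝ) : ℂ) * (-1) ^ (d + 1) *
            CrankDissection.zeta p ^ ((m : ℤ) * (a : ℤ) * k)) •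
          CrankDissection.K p (m * a ^ 2 % p) (CrankDissection.zeta p ^ d)) ∧
    Set.BijOn (fun m : ℕ => m * a ^ 2 % p) (Set.Iio p) (Set.Iio p) ∧
    (∀ m < p, @legendreSym p ⟨hp⟩ ((m * a ^ 2 % p : ℕ) : ℤ) = @legendreSym p ⟨hp⟩ (m : ℤ)) := by
  refine ⟨fun m _ l _ _ z => ?_, fun m hm => CrankDissection.K_slash hp hp3 ha hd A hA hm,
    CrankDissection.bijOn_mul_sq_mod hp ha, fun m _ => ?_⟩
  · refine CrankDissection.summable_seriesTerm hp.pos m ?_ z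
    rw [← pow_mul, mul_comm, pow_mul, (CrankDissection.zeta_isPrimitiveRoot hp.ne_zero).pow_eq_one,
      one_pow]
  · have : Fact p.Prime := ⟨hp⟩
    have ha0 : ((a : ℤ) : ZMod p) ≠ 0 := by
      rw [Int.cast_natCast, Ne, ZMod.natCast_eq_zero_iff]
      intro h
      have := Nat.le_of_dvd (by omega) h
      omega
    rw [Int.natCast_mod, ← legendreSym.mod, Nat.cast_mul, Nat.cast_pow, legendreSym.mul,
      legendreSym.sq_one' p ha0, mul_one]
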